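/- Let $d\ge 1$, let $\Omega\subset\mathbb R^d$ be a bounded open set, and let $0<\alpha_{\min}\le\alpha_{\max}<2$. Consider continuous $\alpha:\mathbb R^d\to[\alpha_{\min},\alpha_{\max}]$, a reaction coefficient $b\ge 0$ on $\Omega$, and a right-hand side $f$. For $h>0$ put $x_j=jh$ $(j\in\mathbb Z^d)$, $\Omega_h=\{x_j : x_j\in\Omega\}$, $\|v\|_{L_h^\infty}=\max_{x_j\in\Omega_h}|v_j|$ ($0$ if $\Omega_h=\emptyset$), and, for a finitely supported grid function $v=(v_j)_{j\in\mathbb Z^d}$, $\mathcal F_h[v](\xi)=h^d\sum_k e^{-\mathbf i\xi\cdot x_k}v_k$ and $$(-\Delta_h)^{a/2}v_j=\frac1{(2\pi)^d}\int_{[-\pi/h,\pi/h]^d}e^{\mathbf i\xi\cdot x_j}\Big(\sum_{p=1}^d\frac4{h^2}\sin^2\frac{\xi_ph}2\Big)^{a/2}\mathcal F_h[v](\xi)\,d\xi .$$ The finite difference scheme is $$(-\Delta_h)^{\alpha(x_j)/2}v_j+b(x_j)v_j=f(x_j)\quad(x_j\in\Omega),\qquad v_j=0\quad(x_j\notin\Omega).\tag{S}$$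 (i) *Solvability.* For every $h>0$ the scheme (S) has exactly one solution $v$. (ii) *Stability.* For every $H>0$ there is a constant $c_3>0$, depending only on $d,\Omega,\alpha_{\min},\alpha_{\max},H$ (not on $h,\alpha,b,f$), such that for all $0<h\le H$ the solution satisfies $\|v\|_{L_h^\infty}\le c_3\|f\|_{L_h^\infty}$. (iii) *Convergence.* For every $H>0$ and $0<s\le 2$ there is a constant $c>0$, depending only on $d,\Omega,\alpha_{\min},\alpha_{\max},H,s$, with the following property. Let $u$ satisfy $$(-\Delta)^{\alpha(x)/2}u(x)+b(x)u(x)=f(x)\quad(x\in\Omega),\qquad u=0\ \text{ on }\mathbb R^d\setminus\Omega,$$ where $$(-\Delta)^{a/2}u(x)=c_{d,a}\,\mathrm{P.V.}\!\int_{\mathbb R^d}\frac{u(x)-u(y)}{|x-y|^{d+a}}\,dy,\qquad c_{d,a}=\frac{2^{a-1}a\,\Gamma((a+d)/2)}{\pi^{d/2}\,\Gamma(1-a/2)},$$ and let $u$ belong to the spectral Barron space $\mathcal B^{s+\alpha_{\max}}(\mathbb R^d)$, that is, $u$ is continuous and integrable and, with $\hat u(\xi)=\int e^{-\mathbf i\xi\cdot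 x}u(x)\,dx$, $$\|u\|_{\mathcal B^{s+\alpha_{\max}}}=\int_{\mathbb R^d}(1+|\xi|^{s+\alpha_{\max}})\,|\hat u(\xi)|\,d\xi<\infty .$$ Then for all $0<h\le H$ the solution $v$ of (S) satisfies $$\max_{x_j\in\Omega_h}|u(x_j)-v_j|\le c\,\|u\|_{\mathcal B^{s+\alpha_{\max}}}\,h^s .$$ -/

import Mathlib

open MeasureTheory Filter Topology

noncomputable section

namespace VarFracLap

/-- The Fourier transform `𝓕[u](ξ) = ∫ e^{-i ξ·x} u(x) dx` of a real function on `ℝᵈ`. -/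
def fourier {d : ℕ} (u : EuclideanSpace ℝ (Fin d) → ℝ) (ξ : EuclideanSpace ℝ (Fin d)) : ℂ :=
  ∫ x, Complex.exp (-(Complex.I * ((inner ℝ ξ x : ℝ) : ℂ))) * (u x : ℂ)

/-- The spectral Barron space `𝓑ᵗ(ℝᵈ)`; its elements are taken with their continuous
representative, since they are evaluated at points. -/
structure MemBarron {d : ℕ} (t : ℝ) (u : EuclideanSpace ℝ (Fin d) → ℝ) : Prop where
  continuous : Continuous u
  integrable : Integrable u
  integrable_fourier : Integrable (fun ξ => (1 + ‖ξ‖ ^ t) * ‖fourier u ξ‖)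

/-- The norm `∫ (1 + |ξ|ᵗ) |𝓕[u](ξ)| dξ` of the spectral Barron space. -/
def barronNorm {d : ℕ} (t : ℝ) (u : EuclideanSpace ℝ (Fin d) → ℝ) : ℝ :=
  ∫ ξ, (1 + ‖ξ‖ ^ t) * ‖fourier u ξ‖

/-- The normalizing constant `c_{d,a}` of the fractional Laplacian of order `a`. -/
def fracConst (d : ℕ) (a : ℝ) : ℝ :=
  2 ^ (a - 1) * a * Real.Gamma ((a + d) / 2) /
    (Real.pi ^ ((d : ℝ) / 2) * Real.Gamma (1 - a / 2))

/-- `(-Δ)^{a/2} u(x)` exists, as a principal value, and equals `l`. -/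
def HasFracLaplacianAt {d : ℕ} (a : ℝ) (u : EuclideanSpace ℝ (Fin d) → ℝ)
    (x : EuclideanSpace ℝ (Fin d)) (l : ℝ) : Prop :=
  (∀ ε : ℝ, 0 < ε →
    IntegrableOn (fun y => (u x - u y) / ‖x - y‖ ^ ((d : ℝ) + a)) {y | ε < ‖x - y‖}) ∧
  Tendsto
    (fun ε : ℝ =>
      fracConst d a * ∫ y in {y | ε < ‖x - y‖}, (u x - u y) / ‖x - y‖ ^ ((d : ℝ) + a))
    (𝓝[>] 0) (𝓝 l)

/-- `u` solves `(-Δ)^{α(x)/2} u + b u = f` in `Ω`, `u = 0` on the complement of `Ω`. -/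
structure IsSolution {d : ℕ} (Ω : Set (EuclideanSpace ℝ (Fin d)))
    (α b f u : EuclideanSpace ℝ (Fin d) → ℝ) : Prop where
  equation : ∀ x ∈ Ω, ∃ l : ℝ, HasFracLaplacianAt (α x) u x l ∧ l + b x * u x = f x
  exterior : ∀ x ∉ Ω, u x = 0

/-- The point `x_j = j h` of the grid `h ℤᵈ`. -/
def gridPoint {d : ℕ} (h : ℝ) (j : Fin d → ℤ) : EuclideanSpace ℝ (Fin d) :=
  WithLp.toLp 2 (fun p => (j p : ℝ) * h)

/-- The semi-discrete Fourier transform of a grid function (indexed by `j ∈ ℤᵈ`). -/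
def discreteFourier {d : ℕ} (h : ℝ) (v : (Fin d → ℤ) → ℝ) (ξ : EuclideanSpace ℝ (Fin d)) : ℂ :=
  (h : ℂ) ^ d *
    ∑' k : Fin d → ℤ,
      Complex.exp (-(Complex.I * ((inner ℝ ξ (gridPoint h k) : ℝ) : ℂ))) * (v k : ℂ)

/-- The multiplier `M_h(ξ) = ∑ₚ (4 / h²) sin² (ξₚ h / 2)`. -/
def multiplier {d : ℕ} (h : ℝ) (ξ : EuclideanSpace ℝ (Fin d)) : ℝ :=
  ∑ p : Fin d, 4 / h ^ 2 * Real.sin (ξ p * h / 2) ^ 2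

/-- The frequency cube `D_h = [-π/h, π/h]ᵈ`. -/
def frequencyCube (d : ℕ) (h : ℝ) : Set (EuclideanSpace ℝ (Fin d)) :=
  {ξ | ∀ p, ξ p ∈ Set.Icc (-(Real.pi / h)) (Real.pi / h)}

/-- The discrete fractional Laplacian of order `a`, evaluated at the grid point `x_j`:
`(2π)^{-d} ∫_{D_h} e^{i ξ·x_j} M_h(ξ)^{a/2} 𝓕_h[v](ξ) dξ`. -/
def discreteFracLaplacian {d : ℕ} (h a : ℝ) (v : (Fin d → ℤ) → ℝ) (j : Fin d → ℤ) : ℂ :=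
  1 / (2 * (Real.pi : ℂ)) ^ d *
    ∫ ξ in frequencyCube d h,
      Complex.exp (Complex.I * ((inner ℝ ξ (gridPoint h j) : ℝ) : ℂ)) *
        ((multiplier h ξ ^ (a / 2) : ℝ) : ℂ) * discreteFourier h v ξ

/-- `v` solves the finite difference scheme
`(-Δ_h)^{α_j/2} v_j + b_j v_j = f_j` for `x_j ∈ Ω`, `v_j = 0` for `x_j ∉ Ω`. -/
structure IsSchemeSolution {d : ℕ} (h : ℝ) (Ω : Set (EuclideanSpace ℝ (Fin d)))
    (α b f : EuclideanSpace ℝ (Fin d) → ℝ) (v : (Fin d → ℤ) → ℝ) : Prop where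
  equation : ∀ j, gridPoint h j ∈ Ω →
    discreteFracLaplacian h (α (gridPoint h j)) v j + ((b (gridPoint h j) * v j : ℝ) : ℂ) =
      ((f (gridPoint h j) : ℝ) : ℂ)
  exterior : ∀ j, gridPoint h j ∉ Ω → v j = 0

/-- The discrete maximum norm over the grid points in `Ω` (finitely many when `Ω` is bounded
and `h > 0`; the value is `0` if there are none). -/
def gridNorm {d : ℕ} (h : ℝ) (Ω : Set (EuclideanSpace ℝ (Fin d))) (v : (Fin d → ℤ) → ℝ) : ℝ :=
  ⨆ j : {j : Fin d → ℤ // gridPoint h j ∈ Ω}, |v j|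

/-- The standing assumption on the variable order:
`α` is continuous and `αmin ≤ α ≤ αmax`. -/
structure IsOrder {d : ℕ} (αmin αmax : ℝ) (α : EuclideanSpace ℝ (Fin d) → ℝ) : Prop where
  continuous : Continuous α
  mem_Icc : ∀ x, α x ∈ Set.Icc αmin αmax

end VarFracLap

end

/-!
The proof rests on two facts about the discrete fractional Laplacian.

*It is the generator of a random walk.* With `P(ξ) = (∑ₚ cos (ξₚ h)) / d` one has
`M_h = (2d / h²) (1 - P)`, and in the binomial series `1 - (1 - P)^{a/2} = ∑ₙ cₙ Pⁿ` all `cₙ` are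
nonnegative, while `Pⁿ` is the characteristic function of the simple random walk after `n` steps.
Hence `(-Δ_h)^{a/2} v_j = κ v_j - ∑ₖ w_{j-k} v_k` with `w ≥ 0` and `κ = ∑ₘ wₘ`
(`exists_isJumpKernel`, `IsJumpKernel.discreteFracLaplacian_eq`). At a point where `|v|` is maximal
the operator therefore dominates `|v_j|` times the total weight of the jumps which leave `Ω`
(`IsJumpKernel.tail_mul_abs_le`). Comparing the symbol at the frequencies `ξ` and `N ξ` shows that
this weight is bounded below uniformly in `h ≤ H` and in the order, since the order stays below `2`
(`IsJumpKernel.exists_tail_lower_bound`). This gives stability, for each equation with its own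
order, and stability gives unique solvability of the finite linear system.

*It is consistent on the Barron space.* By Fourier inversion and the periodicity of `M_h`, the
difference operator applied to the samples of `u` is the Fourier multiplier `M_h^{a/2}` applied to
`u` (`IsJumpKernel.sum_eq_fourierMultiplier`). The principal value is the multiplier `|ξ|^a`
(`HasFracLaplacianAt.eq_fourierMultiplier`), by the explicit evaluation of
`∫ (1 - cos (ξ·z)) |z|^{-d-a} dz` (`integral_one_sub_cos_div_norm_rpow`). Since
`0 ≤ |ξ|^a - M_h(ξ)^{a/2} ≤ h^s |ξ|^{s+a}`, the consistency error is at most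
`‖u‖_{𝓑^{s+αmax}} h^s`, and the error estimate follows by applying stability to `u - v`.
-/

namespace VarFracLap

/-! ### The binomial series of `1 - (1 - x) ^ β` -/

theorem neg_one_pow_mul_choose_nonpos {β : ℝ} (h0 : 0 ≤ β) (h1 : β ≤ 1) (n : ℕ) :
    (-1) ^ (n + 1) * Ring.choose β (n + 1) ≤ 0 := by
  have key : (-1) ^ (n + 1) * (descPochhammer ℤ (n + 1)).smeval β ≤ 0 := by
    induction n with
    | zero => simpa using h0
    | succ n ih =>
      rw [descPochhammer_succ_right, Polynomial.smeval_mul]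
      have e : (Polynomial.X - ((n + 1 : ℕ) : Polynomial ℤ)).smeval β = β - (n + 1) := by
        simp [Polynomial.smeval_sub, Polynomial.smeval_natCast, Polynomial.smeval_X]
      rw [e, pow_succ]
      have : 0 ≤ (n : ℝ) + 1 - β := by
        have := n.cast_nonneg (α := ℝ)
        linarith
      nlinarith [mul_nonneg this (neg_nonneg.2 ih)]
  rw [Ring.descPochhammer_eq_factorial_smul_choose, nsmul_eq_mul, mul_left_comm] at key
  exact nonpos_of_mul_nonpos_right key (by positivity)

/-- The coefficients are nonnegative, so their partial sums are bounded by letting `x → 1`; the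
series then converges absolutely on all of `[-1, 1]`, endpoints included. -/
theorem exists_hasSum_one_sub_one_sub_rpow {β : ℝ} (h0 : 0 < β) (h1 : β ≤ 1) :
    ∃ c : ℕ → ℝ, (∀ n, 0 ≤ c n) ∧ ∀ x ∈ Set.Icc (-1 : ℝ) 1,
      HasSum (fun n => c n * x ^ n) (1 - (1 - x) ^ β) := by
  obtain ⟨c, hc, hlt⟩ : ∃ c : ℕ → ℝ, (∀ n, 0 ≤ c n) ∧ ∀ x : ℝ, |x| < 1 →
      HasSum (fun n => c n * x ^ n) (1 - (1 - x) ^ β) := by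
    refine ⟨fun n => (if n = 0 then 1 else 0) - (-1) ^ n * Ring.choose β n, fun n => ?_,
      fun x hx => ?_⟩
    · rcases n with _ | n
      · simp
      · simpa using neg_one_pow_mul_choose_nonpos h0.le h1 n
    · have h := (Real.one_add_rpow_hasFPowerSeriesOnBall_zero (a := β)).hasSum (y := -x)
        (by simpa [enorm_eq_nnnorm] using! hx)
      simp only [zero_add, binomialSeries_apply, List.ofFn_const, List.prod_replicate,
        smul_eq_mul] at h
      rw [← sub_eq_add_neg] at h
      convert! (hasSum_ite_eq 0 (1 : ℝ)).sub h using 1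
      funext n
      rw [neg_pow x n]
      rcases n with _ | n
      · simp
      · simp only [Nat.add_eq_zero_iff, one_ne_zero, and_false, if_false]
        ring
  have hnonneg : ∀ x : ℝ, 0 ≤ x → x < 1 → ∀ s : Finset ℕ, ∑ n ∈ s, c n * x ^ n ≤ 1 := by
    intro x hx0 hx1 s
    have h := hlt x (abs_lt.2 ⟨by linarith, hx1⟩)
    refine (sum_le_hasSum s (fun n _ => mul_nonneg (hc n) (pow_nonneg hx0 n)) h).trans ?_
    have := Real.rpow_nonneg (by linarith : 0 ≤ 1 - x) β
    linarith
  -- the partial sums at `x = 1` are limits of partial sums at `x < 1`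
  have hsum : Summable c := by
    refine summable_of_sum_le hc (c := 1) fun s => ?_
    have ht : Tendsto (fun x : ℝ => ∑ n ∈ s, c n * x ^ n) (𝓝[<] 1) (𝓝 (∑ n ∈ s, c n * 1 ^ n)) := by
      refine Tendsto.mono_left (Continuous.tendsto ?_ 1) nhdsWithin_le_nhds
      fun_prop
    simp only [one_pow, mul_one] at ht
    refine le_of_tendsto ht ?_
    filter_upwards [Ioo_mem_nhdsLT (zero_lt_one (α := ℝ))] with x hx
    exact hnonneg x hx.1.le hx.2 s
  refine ⟨c, hc, fun x hx => ?_⟩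
  have hbound : ∀ x ∈ Set.Icc (-1 : ℝ) 1, ∀ n, ‖c n * x ^ n‖ ≤ c n := by
    intro x hx n
    rw [norm_mul, norm_pow, Real.norm_of_nonneg (hc n)]
    exact mul_le_of_le_one_right (hc n) (pow_le_one₀ (norm_nonneg x) (abs_le.2 hx))
  have hs : ∀ x ∈ Set.Icc (-1 : ℝ) 1, Summable fun n => c n * x ^ n := fun x hx =>
    hsum.of_norm_bounded (hbound x hx)
  have hcont : ContinuousOn (fun x : ℝ => ∑' n, c n * x ^ n) (Set.Icc (-1) 1) :=
    continuousOn_tsum (fun n => by fun_prop) hsum fun n x hx => hbound x hx n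
  have hcont' : Continuous (fun x : ℝ => 1 - (1 - x) ^ β) :=
    continuous_const.sub ((continuous_const.sub continuous_id).rpow_const fun _ => Or.inr h0.le)
  -- both sides are continuous on `[-1, 1]` and agree on the dense subset `(-1, 1)`
  have heq : Set.EqOn (fun x : ℝ => ∑' n, c n * x ^ n) (fun x => 1 - (1 - x) ^ β)
      (Set.Icc (-1) 1) := by
    refine Set.EqOn.of_subset_closure (s := Set.Ioo (-1) 1) (fun x hx => ?_) hcont
      hcont'.continuousOn Set.Ioo_subset_Icc_self (by rw [closure_Ioo (by norm_num)])
    exact (hlt x (abs_lt.2 hx)).tsum_eq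
  have h := (hs x hx).hasSum
  rwa [show ∑' n, c n * x ^ n = _ from heq hx] at h

/-! ### Grid points and the weights of the difference operator -/

section Grid

variable {d : ℕ} (h : ℝ)

@[simp]
theorem gridPoint_apply (j : Fin d → ℤ) (p : Fin d) : gridPoint h j p = (j p : ℝ) * h := rfl

@[simp]
theorem gridPoint_zero : gridPoint h (0 : Fin d → ℤ) = 0 := by
  ext p; simp

theorem gridPoint_sub (j k : Fin d → ℤ) :
    gridPoint h (j - k) = gridPoint h j - gridPoint h k := by
  ext p; simp [sub_mul]

theorem inner_gridPoint (ξ : EuclideanSpace ℝ (Fin d)) (j : Fin d → ℤ) :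
    inner ℝ ξ (gridPoint h j) = ∑ p, ξ p * ((j p : ℝ) * h) := by
  simp [PiLp.inner_apply, mul_comm]

theorem inner_gridPoint_single (ξ : EuclideanSpace ℝ (Fin d)) (p : Fin d) (z : ℤ) :
    inner ℝ ξ (gridPoint h (Pi.single p z)) = ξ p * ((z : ℝ) * h) := by
  rw [inner_gridPoint, Finset.sum_eq_single p]
  · simp
  · intro q _ hq; simp [hq]
  · simp

theorem norm_gridChar (ξ x : EuclideanSpace ℝ (Fin d)) :
    ‖Complex.exp (-(Complex.I * ((inner ℝ ξ x : ℝ) : ℂ)))‖ = 1 := by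
  rw [mul_comm, ← neg_mul, ← Complex.ofReal_neg, Complex.norm_exp_ofReal_mul_I]

end Grid

section Weights

variable {d : ℕ}

/-- The `n`-th power of `(∑ₚ cos (ξₚ h)) / d` is the characteristic function of the simple random
walk on `h ℤᵈ` after `n` steps; `q` is its distribution. -/
theorem exists_walkWeights (h : ℝ) (n : ℕ) :
    ∃ q : (Fin d → ℤ) → ℝ, (∀ m, 0 ≤ q m) ∧ ∀ ξ : EuclideanSpace ℝ (Fin d),
      HasSum (fun m => (q m : ℂ) *
        Complex.exp (-(Complex.I * ((inner ℝ ξ (gridPoint h m) : ℝ) : ℂ))))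
        ((((∑ p, Real.cos (ξ p * h)) / d) ^ n : ℝ) : ℂ) := by
  induction n with
  | zero =>
    refine ⟨Pi.single 0 1, fun m => ?_, fun ξ => ?_⟩
    · by_cases hm : m = 0
      · simp [hm]
      · simp [hm]
    · convert! hasSum_ite_eq (0 : Fin d → ℤ) (1 : ℂ) using 1
      · funext m
        by_cases hm : m = 0
        · simp [hm]
        · simp [hm]
  | succ n ih =>
    obtain ⟨q, hq0, hq⟩ := ih
    refine ⟨fun m => (∑ p, (q (m - Pi.single p 1) + q (m - Pi.single p (-1))) / 2) / d,
      fun m => ?_, fun ξ => ?_⟩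
    · exact div_nonneg (Finset.sum_nonneg fun p _ =>
        div_nonneg (add_nonneg (hq0 _) (hq0 _)) zero_le_two) d.cast_nonneg
    · have shift (e : Fin d → ℤ) : HasSum (fun m => (q (m - e) : ℂ) *
          Complex.exp (-(Complex.I * ((inner ℝ ξ (gridPoint h m) : ℝ) : ℂ))))
          (Complex.exp (-(Complex.I * ((inner ℝ ξ (gridPoint h e) : ℝ) : ℂ))) *
            ((((∑ p, Real.cos (ξ p * h)) / d) ^ n : ℝ) : ℂ)) := by
        have := ((Equiv.subRight e).hasSum_iff.2 (hq ξ)).mul_left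
          (Complex.exp (-(Complex.I * ((inner ℝ ξ (gridPoint h e) : ℝ) : ℂ))))
        refine this.congr_fun fun m => ?_
        simp only [Function.comp_apply, Equiv.subRight_apply, gridPoint_sub, inner_sub_right]
        rw [mul_left_comm, ← Complex.exp_add]
        push_cast
        ring_nf
      have := (hasSum_sum fun p (_ : p ∈ Finset.univ) =>
        ((shift (Pi.single p 1)).add (shift (Pi.single p (-1)))).div_const 2).div_const (d : ℂ)
      convert! this using 1
      · funext m
        push_cast
        rw [div_mul_eq_mul_div, Finset.sum_mul]
        congr 1
        refine Finset.sum_congr rfl fun p _ => ?_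
        ring
      · rw [pow_succ, mul_comm]
        simp only [inner_gridPoint_single]
        push_cast
        rw [div_mul_eq_mul_div, Finset.sum_mul]
        congr 1
        refine Finset.sum_congr rfl fun p _ => ?_
        rw [Complex.cos]
        ring_nf

theorem multiplier_eq_cos (hd : 1 ≤ d) (h : ℝ) (ξ : EuclideanSpace ℝ (Fin d)) :
    multiplier h ξ = 2 * d / h ^ 2 * (1 - (∑ p, Real.cos (ξ p * h)) / d) := by
  have hd' : (d : ℝ) ≠ 0 := by positivity
  have : ∀ p, 4 / h ^ 2 * Real.sin (ξ p * h / 2) ^ 2 = 2 / h ^ 2 * (1 - Real.cos (ξ p * h)) := by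
    intro p
    rw [Real.sin_sq_eq_half_sub]
    ring_nf
  rw [multiplier, Finset.sum_congr rfl fun p _ => this p, ← Finset.mul_sum,
    Finset.sum_sub_distrib]
  simp
  field_simp

theorem multiplier_nonneg (h : ℝ) (ξ : EuclideanSpace ℝ (Fin d)) : 0 ≤ multiplier h ξ :=
  Finset.sum_nonneg fun p _ => by positivity

@[simp]
theorem multiplier_zero (h : ℝ) : multiplier h (0 : EuclideanSpace ℝ (Fin d)) = 0 := by
  simp [multiplier]

/-- `w` is the family of nonnegative weights with `∑ₘ wₘ e^{-i ξ·x_m} = κ - M_h(ξ)^{a/2}`. Then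
`(-Δ_h)^{a/2} v_j = κ v_j - ∑ₖ w_{j-k} v_k`, where `κ = ∑ₘ wₘ`: up to sign, `(-Δ_h)^{a/2}` is the
generator of a random walk which jumps by `x_m` with rate `wₘ`. The weight `w₀` need not vanish, so
`κ` is not normalized. -/
structure IsJumpKernel (h a κ : ℝ) (w : (Fin d → ℤ) → ℝ) : Prop where
  nonneg : ∀ m, 0 ≤ w m
  hasSum_char : ∀ ξ : EuclideanSpace ℝ (Fin d),
    HasSum (fun m => (w m : ℂ) *
      Complex.exp (-(Complex.I * ((inner ℝ ξ (gridPoint h m) : ℝ) : ℂ))))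
      ((κ - multiplier h ξ ^ (a / 2) : ℝ) : ℂ)

/-- With `P = (∑ₚ cos (ξₚ h)) / d` the symbol is `(2d / h²)^{a/2} (1 - P)^{a/2}`, and the binomial
series writes `1 - (1 - P)^{a/2}` as a combination of powers of `P` with nonnegative coefficients.
-/
theorem exists_isJumpKernel (hd : 1 ≤ d) {h a : ℝ} (ha0 : 0 < a) (ha2 : a ≤ 2) :
    ∃ κ w, IsJumpKernel (d := d) h a κ w := by
  obtain ⟨c, hc0, hc⟩ := exists_hasSum_one_sub_one_sub_rpow (β := a / 2) (by linarith) (by linarith)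
  choose q hq0 hq using exists_walkWeights (d := d) h
  have hd' : (0 : ℝ) < d := by exact_mod_cast hd
  have hP : ∀ ξ : EuclideanSpace ℝ (Fin d), (∑ p, Real.cos (ξ p * h)) / d ∈ Set.Icc (-1 : ℝ) 1 := by
    intro ξ
    constructor
    · rw [le_div_iff₀ hd']
      calc -1 * (d : ℝ) = ∑ p : Fin d, (-1 : ℝ) := by simp
        _ ≤ _ := Finset.sum_le_sum fun p _ => Real.neg_one_le_cos _
    · rw [div_le_iff₀ hd']
      calc _ ≤ ∑ p : Fin d, (1 : ℝ) := Finset.sum_le_sum fun p _ => Real.cos_le_one _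
        _ = _ := by simp
  have hcsum : Summable c := by simpa using (hc 1 (by norm_num)).summable
  have hq1 : ∀ n, HasSum (q n) 1 := by
    intro n
    have := hq n 0
    simp only [inner_zero_left, Complex.ofReal_zero, mul_zero, neg_zero, Complex.exp_zero, mul_one,
      PiLp.zero_apply, zero_mul, Real.cos_zero] at this
    rw [Complex.hasSum_ofReal] at this
    simpa [hd'.ne'] using this
  have hprod : Summable fun x : ℕ × (Fin d → ℤ) => c x.1 * q x.1 x.2 := by
    refine (summable_prod_of_nonneg fun x => mul_nonneg (hc0 x.1) (hq0 x.1 x.2)).2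
      ⟨fun n => (hq1 n).summable.mul_left (c n), ?_⟩
    convert! hcsum using 2 with n
    exact (tsum_mul_left (a := c n)).trans (by rw [(hq1 n).tsum_eq, mul_one])
  have hprod' : Summable fun x : (Fin d → ℤ) × ℕ => c x.2 * q x.2 x.1 :=
    hprod.prod_symm
  refine ⟨(2 * d / h ^ 2) ^ (a / 2), fun m => (2 * d / h ^ 2) ^ (a / 2) * ∑' n, c n * q n m,
    fun m => mul_nonneg (by positivity) (tsum_nonneg fun n => mul_nonneg (hc0 _) (hq0 _ _)),
    fun ξ => ?_⟩
  set E : (Fin d → ℤ) → ℂ := fun m =>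
    Complex.exp (-(Complex.I * ((inner ℝ ξ (gridPoint h m) : ℝ) : ℂ))) with hE
  have hEn : ∀ m, ‖E m‖ = 1 := fun m => norm_gridChar ξ _
  have hF : Summable fun x : (Fin d → ℤ) × ℕ => ((c x.2 * q x.2 x.1 : ℝ) : ℂ) * E x.1 := by
    refine hprod'.of_norm_bounded fun x => ?_
    rw [norm_mul, hEn, mul_one, Complex.norm_real,
      Real.norm_of_nonneg (mul_nonneg (hc0 _) (hq0 _ _))]
  have h1 := hF.hasSum.prod_fiberwise (g := fun m => ((∑' n, c n * q n m : ℝ) : ℂ) * E m)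
    fun m => ((Complex.hasSum_ofReal.2 (hprod'.prod_factor m).hasSum)).mul_right _
  have hF' := (Equiv.prodComm _ _).hasSum_iff.2 hF.hasSum
  have h2 := hF'.prod_fiberwise
    (g := fun n => ((c n * ((∑ p, Real.cos (ξ p * h)) / d) ^ n : ℝ) : ℂ)) fun n => by
      simpa [mul_assoc] using! (hq n ξ).mul_left (c n : ℂ)
  have h3 := h2.unique (Complex.hasSum_ofReal.2 (hc _ (hP ξ)))
  rw [h3] at h1
  have h4 := h1.mul_left (((2 * d / h ^ 2) ^ (a / 2) : ℝ) : ℂ)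
  rw [multiplier_eq_cos hd, Real.mul_rpow (by positivity) (by linarith [(hP ξ).2])]
  convert! h4 using 1
  · funext m
    push_cast
    ring
  · push_cast
    ring

namespace IsJumpKernel

variable {h a κ : ℝ} {w : (Fin d → ℤ) → ℝ}

theorem hasSum (hw : IsJumpKernel h a κ w) (ha : 0 < a) : HasSum w κ := by
  have := hw.hasSum_char 0
  simp only [inner_zero_left, Complex.ofReal_zero, mul_zero, neg_zero, Complex.exp_zero, mul_one,
    multiplier_zero] at this
  rw [Complex.hasSum_ofReal, Real.zero_rpow (by linarith)] at this
  simpa using this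

theorem hasSum_one_sub_cos (hw : IsJumpKernel h a κ w) (ha : 0 < a)
    (ξ : EuclideanSpace ℝ (Fin d)) :
    HasSum (fun m => w m * (1 - Real.cos (inner ℝ ξ (gridPoint h m))))
      (multiplier h ξ ^ (a / 2)) := by
  have h1 := (hw.hasSum ha).sub (Complex.hasSum_re (hw.hasSum_char ξ))
  convert! h1 using 1
  · funext m
    rw [mul_comm Complex.I, ← neg_mul, ← Complex.ofReal_neg, Complex.re_ofReal_mul,
      Complex.exp_ofReal_mul_I_re, Real.cos_neg]
    ring
  · simp

end IsJumpKernel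

end Weights

/-! ### The difference operator on finitely supported grid functions -/

section Formula

variable {d : ℕ}

theorem integral_Icc_exp_int_mul {h : ℝ} (hh : 0 < h) (n : ℤ) :
    ∫ t in Set.Icc (-(Real.pi / h)) (Real.pi / h),
      Complex.exp (Complex.I * ((t * ((n : ℝ) * h) : ℝ) : ℂ)) =
      if n = 0 then ((2 * Real.pi / h : ℝ) : ℂ) else 0 := by
  have hle : -(Real.pi / h) ≤ Real.pi / h := by
    have : 0 < Real.pi / h := by positivity
    linarith
  rw [integral_Icc_eq_integral_Ioc, ← intervalIntegral.integral_of_le hle]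
  split_ifs with hn
  · simp [hn]
    ring
  · have hc : Complex.I * n * h ≠ 0 := by simp [hn, hh.ne']
    have : ∀ t : ℝ, Complex.exp (Complex.I * ((t * ((n : ℝ) * h) : ℝ) : ℂ)) =
        Complex.exp (Complex.I * n * h * t) := by
      intro t
      push_cast
      ring_nf
    simp only [this]
    rw [integral_exp_mul_complex hc, div_eq_zero_iff]
    left
    rw [sub_eq_zero, Complex.exp_eq_exp_iff_exists_int]
    refine ⟨n, ?_⟩
    have : (h : ℂ) ≠ 0 := by simp [hh.ne']
    push_cast
    field_simp
    ring

theorem frequencyCube_eq_preimage (h : ℝ) :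
    frequencyCube d h = (MeasurableEquiv.toLp 2 (Fin d → ℝ)).symm ⁻¹'
      Set.univ.pi fun _ => Set.Icc (-(Real.pi / h)) (Real.pi / h) := by
  ext ξ
  simp only [frequencyCube, Set.mem_preimage, Set.mem_univ_pi, Set.mem_ofPred_eq]
  rfl

theorem integral_frequencyCube_exp {h : ℝ} (hh : 0 < h) (m : Fin d → ℤ) :
    ∫ ξ in frequencyCube d h,
      Complex.exp (Complex.I * ((inner ℝ ξ (gridPoint h m) : ℝ) : ℂ)) =
      if m = 0 then ((2 * Real.pi / h : ℝ) : ℂ) ^ d else 0 := by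
  let g : (Fin d → ℝ) → ℂ := fun x =>
    ∏ p, Complex.exp (Complex.I * ((x p * ((m p : ℝ) * h) : ℝ) : ℂ))
  have hprod : ∀ ξ : EuclideanSpace ℝ (Fin d),
      Complex.exp (Complex.I * ((inner ℝ ξ (gridPoint h m) : ℝ) : ℂ)) =
        g ((MeasurableEquiv.toLp 2 (Fin d → ℝ)).symm ξ) := by
    intro ξ
    rw [inner_gridPoint, Complex.ofReal_sum, Finset.mul_sum, Complex.exp_sum]
    rfl
  rw [frequencyCube_eq_preimage]
  refine (integral_congr_ae (ae_of_all _ hprod)).trans ?_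
  refine ((EuclideanSpace.volume_preserving_symm_measurableEquiv_toLp
    (Fin d)).setIntegral_preimage_emb (MeasurableEquiv.measurableEmbedding _) g _).trans ?_
  rw [volume_pi, Measure.restrict_pi_pi,
    integral_fintype_prod_eq_prod (𝕜 := ℂ)
      (fun p (t : ℝ) => Complex.exp (Complex.I * ((t * ((m p : ℝ) * h) : ℝ) : ℂ)))]
  simp only [integral_Icc_exp_int_mul hh]
  split_ifs with hm
  · simp [hm, div_pow]
  · obtain ⟨p, hp⟩ := Function.ne_iff.1 hm
    exact Finset.prod_eq_zero (Finset.mem_univ p) (if_neg hp)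

theorem isCompact_frequencyCube (h : ℝ) : IsCompact (frequencyCube d h) := by
  have : frequencyCube d h = EuclideanSpace.equiv (Fin d) ℝ ⁻¹'
      Set.univ.pi fun _ => Set.Icc (-(Real.pi / h)) (Real.pi / h) := by
    ext ξ
    simp only [frequencyCube, Set.mem_preimage, Set.mem_univ_pi, Set.mem_ofPred_eq]
    rfl
  rw [this]
  exact (EuclideanSpace.equiv (Fin d) ℝ).toHomeomorph.isCompact_preimage.2
    (isCompact_univ_pi fun _ => isCompact_Icc)

theorem integrableOn_frequencyCube_exp (h : ℝ) (x : EuclideanSpace ℝ (Fin d)) :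
    IntegrableOn (fun ξ : EuclideanSpace ℝ (Fin d) =>
      Complex.exp (Complex.I * ((inner ℝ ξ x : ℝ) : ℂ))) (frequencyCube d h) :=
  ContinuousOn.integrableOn_compact (isCompact_frequencyCube h) (by fun_prop)

theorem continuous_multiplier_rpow (h : ℝ) {a : ℝ} (ha : 0 ≤ a) :
    Continuous fun ξ : EuclideanSpace ℝ (Fin d) => multiplier h ξ ^ (a / 2) := by
  refine Continuous.rpow_const ?_ fun _ => Or.inr (by linarith)
  unfold multiplier
  fun_prop

namespace IsJumpKernel

variable {h a κ : ℝ} {w : (Fin d → ℤ) → ℝ}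

/-- The Fourier coefficients of the symbol, by orthogonality of the characters on the frequency
cube. -/
theorem integral_exp_mul_multiplier (hw : IsJumpKernel h a κ w) (ha : 0 < a) (hh : 0 < h)
    (n : Fin d → ℤ) :
    ∫ ξ in frequencyCube d h, Complex.exp (Complex.I * ((inner ℝ ξ (gridPoint h n) : ℝ) : ℂ)) *
      ((multiplier h ξ ^ (a / 2) : ℝ) : ℂ) =
      ((2 * Real.pi / h : ℝ) : ℂ) ^ d * (((if n = 0 then κ else 0) - w n : ℝ) : ℂ) := by
  set E : (Fin d → ℤ) → EuclideanSpace ℝ (Fin d) → ℂ := fun m ξ =>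
    Complex.exp (Complex.I * ((inner ℝ ξ (gridPoint h m) : ℝ) : ℂ)) with hE
  have hEn : ∀ m ξ, ‖E m ξ‖ = 1 := fun m ξ => by
    change ‖Complex.exp _‖ = 1
    rw [mul_comm]
    exact Complex.norm_exp_ofReal_mul_I _
  have hEint : ∀ m, IntegrableOn (E m) (frequencyCube d h) := fun m =>
    integrableOn_frequencyCube_exp h _
  have hsum : ∀ ξ, HasSum (fun m => (w m : ℂ) * E (n - m) ξ)
      (κ * E n ξ - E n ξ * ((multiplier h ξ ^ (a / 2) : ℝ) : ℂ)) := by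
    intro ξ
    convert! (hw.hasSum_char ξ).mul_left (E n ξ) using 1
    · funext m
      rw [hE]
      simp only [gridPoint_sub, inner_sub_right]
      rw [mul_left_comm, ← Complex.exp_add]
      push_cast
      ring_nf
    · push_cast
      ring
  have key := hasSum_integral_of_summable_integral_norm
    (μ := volume.restrict (frequencyCube d h)) (F := fun m ξ => (w m : ℂ) * E (n - m) ξ)
    (fun m => (hEint _).const_mul _) (by
      simp only [norm_mul, hEn, mul_one, integral_const, smul_eq_mul, Complex.norm_real,
        Real.norm_of_nonneg (hw.nonneg _)]
      exact (hw.hasSum ha).summable.mul_left _)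
  have hterm : ∀ m, ∫ ξ in frequencyCube d h, (w m : ℂ) * E (n - m) ξ =
      if m = n then (w n : ℂ) * ((2 * Real.pi / h : ℝ) : ℂ) ^ d else 0 := by
    intro m
    rw [integral_const_mul, hE, integral_frequencyCube_exp hh]
    by_cases hm : m = n
    · simp [hm]
    · simp [hm, sub_eq_zero, Ne.symm hm]
  simp only [hterm, (hsum _).tsum_eq] at key
  have h1 := key.unique (hasSum_ite_eq n _)
  have hM : IntegrableOn (fun ξ => E n ξ * ((multiplier h ξ ^ (a / 2) : ℝ) : ℂ))
      (frequencyCube d h) := by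
    refine ContinuousOn.integrableOn_compact (isCompact_frequencyCube h)
      (Continuous.continuousOn ?_)
    have := continuous_multiplier_rpow (d := d) h ha.le
    fun_prop
  rw [integral_sub ((hEint n).const_mul _) hM, integral_const_mul, hE,
    integral_frequencyCube_exp hh] at h1
  rw [← sub_eq_zero] at h1 ⊢
  rw [← neg_eq_zero, ← h1]
  split_ifs <;> push_cast <;> ring

theorem discreteFracLaplacian_eq (hw : IsJumpKernel h a κ w) (ha : 0 < a) (hh : 0 < h)
    {v : (Fin d → ℤ) → ℝ} {S : Finset (Fin d → ℤ)} (hv : ∀ k ∉ S, v k = 0) (j : Fin d → ℤ) :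
    discreteFracLaplacian h a v j = ((κ * v j - ∑ k ∈ S, w (j - k) * v k : ℝ) : ℂ) := by
  have hF : ∀ ξ, discreteFourier h v ξ = (h : ℂ) ^ d * ∑ k ∈ S,
      Complex.exp (-(Complex.I * ((inner ℝ ξ (gridPoint h k) : ℝ) : ℂ))) * (v k : ℂ) := by
    intro ξ
    rw [discreteFourier, tsum_eq_sum fun k hk => by rw [hv k hk]; simp]
  have hint : ∀ ξ, Complex.exp (Complex.I * ((inner ℝ ξ (gridPoint h j) : ℝ) : ℂ)) *
        ((multiplier h ξ ^ (a / 2) : ℝ) : ℂ) * discreteFourier h v ξ =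
      (h : ℂ) ^ d * ∑ k ∈ S, (v k : ℂ) *
        (Complex.exp (Complex.I * ((inner ℝ ξ (gridPoint h (j - k)) : ℝ) : ℂ)) *
        ((multiplier h ξ ^ (a / 2) : ℝ) : ℂ)) := by
    intro ξ
    rw [hF, mul_left_comm, Finset.mul_sum]
    congr 1
    refine Finset.sum_congr rfl fun k _ => ?_
    rw [gridPoint_sub, inner_sub_right, Complex.ofReal_sub, mul_sub, sub_eq_add_neg,
      Complex.exp_add]
    ring
  have hI : ∀ n, IntegrableOn (fun ξ : EuclideanSpace ℝ (Fin d) =>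
      Complex.exp (Complex.I * ((inner ℝ ξ (gridPoint h n) : ℝ) : ℂ)) *
        ((multiplier h ξ ^ (a / 2) : ℝ) : ℂ)) (frequencyCube d h) := by
    intro n
    refine ContinuousOn.integrableOn_compact (isCompact_frequencyCube h)
      (Continuous.continuousOn ?_)
    have := continuous_multiplier_rpow (d := d) h ha.le
    fun_prop
  rw [discreteFracLaplacian]
  simp only [hint]
  rw [integral_const_mul, integral_finsetSum _ fun k _ => (hI _).const_mul _]
  simp only [integral_const_mul, hw.integral_exp_mul_multiplier ha hh, sub_eq_zero]
  have hpi : (Real.pi : ℂ) ≠ 0 := by simp [Real.pi_ne_zero]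
  have hh' : (h : ℂ) ≠ 0 := by simp [hh.ne']
  have e : ∀ k, (v k : ℂ) * (((2 * Real.pi / h : ℝ) : ℂ) ^ d *
      (((if j = k then κ else 0) - w (j - k) : ℝ) : ℂ)) = ((2 * Real.pi / h : ℝ) : ℂ) ^ d *
      (((if j = k then κ * v k else 0) - w (j - k) * v k : ℝ) : ℂ) := by
    intro k
    split_ifs <;> push_cast <;> ring
  simp only [e]
  rw [← Finset.mul_sum, ← mul_assoc, ← mul_assoc]
  have e2 : 1 / (2 * (Real.pi : ℂ)) ^ d * (h : ℂ) ^ d * ((2 * Real.pi / h : ℝ) : ℂ) ^ d = 1 := by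
    push_cast
    rw [div_pow]
    field_simp
  rw [e2, one_mul, ← Complex.ofReal_sum, Finset.sum_sub_distrib, Finset.sum_ite_eq]
  split_ifs with hj
  · rfl
  · rw [hv j hj]; simp

end IsJumpKernel

end Formula

/-! ### Lower bound for the long-range weights -/

section Tail

variable {d : ℕ}

theorem sin_nat_mul_sq_le (n : ℕ) (x : ℝ) :
    Real.sin (n * x) ^ 2 ≤ (n : ℝ) ^ 2 * Real.sin x ^ 2 := by
  have : |Real.sin (n * x)| ≤ n * |Real.sin x| := by
    induction n with
    | zero => simp
    | succ n ih =>
      push_cast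
      rw [add_mul, one_mul, Real.sin_add, add_mul, one_mul]
      refine (abs_add_le _ _).trans (add_le_add ?_ ?_)
      · rw [abs_mul]
        exact (mul_le_of_le_one_right (abs_nonneg _) (Real.abs_cos_le_one _)).trans ih
      · rw [abs_mul]
        exact mul_le_of_le_one_left (abs_nonneg _) (Real.abs_cos_le_one _)
  rw [← sq_abs (Real.sin (n * x)), ← sq_abs (Real.sin x), ← mul_pow]
  exact pow_le_pow_left₀ (abs_nonneg _) this 2

theorem multiplier_nat_smul_le (h : ℝ) (n : ℕ) (ξ : EuclideanSpace ℝ (Fin d)) :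
    multiplier h ((n : ℝ) • ξ) ≤ (n : ℝ) ^ 2 * multiplier h ξ := by
  rw [multiplier, multiplier, Finset.mul_sum]
  refine Finset.sum_le_sum fun p _ => ?_
  have := sin_nat_mul_sq_le n (ξ p * h / 2)
  rw [PiLp.smul_apply, smul_eq_mul, show (n : ℝ) * ξ p * h / 2 = n * (ξ p * h / 2) by ring,
    mul_left_comm]
  exact mul_le_mul_of_nonneg_left this (by positivity)

theorem sq_le_multiplier_single {h t : ℝ} (hh : 0 < h) (ht : 0 ≤ t) (hth : t * h ≤ Real.pi)
    (p : Fin d) :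
    (2 / Real.pi * t) ^ 2 ≤ multiplier h (EuclideanSpace.single p t) := by
  refine le_trans ?_ (Finset.single_le_sum (fun q _ => by positivity) (Finset.mem_univ p))
  have h1 : 2 / Real.pi * (t * h / 2) ≤ Real.sin (t * h / 2) :=
    Real.mul_le_sin (by positivity) (by linarith)
  have h2 : (2 / Real.pi * (t * h / 2)) ^ 2 ≤ Real.sin (t * h / 2) ^ 2 :=
    pow_le_pow_left₀ (by positivity) h1 2
  calc (2 / Real.pi * t) ^ 2 = 4 / h ^ 2 * (2 / Real.pi * (t * h / 2)) ^ 2 := by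
        field_simp
        ring
    _ ≤ _ := by
        simpa using mul_le_mul_of_nonneg_left h2 (by positivity : 0 ≤ 4 / h ^ 2)

theorem one_sub_cos_le_of_nat_mul {n : ℕ} (hn : 1 ≤ n) {y : ℝ} (hy : |n * y| ≤ Real.pi) :
    1 - Real.cos y ≤ Real.pi ^ 2 / 4 / (n : ℝ) ^ 2 * (1 - Real.cos (n * y)) := by
  have hn' : (0 : ℝ) < n := by exact_mod_cast hn
  have h1 := Real.one_sub_sq_div_two_le_cos (x := y)
  have h2 := Real.cos_le_one_sub_mul_cos_sq hy
  calc 1 - Real.cos y ≤ y ^ 2 / 2 := by linarith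
    _ = Real.pi ^ 2 / 4 / (n : ℝ) ^ 2 * (2 / Real.pi ^ 2 * (n * y) ^ 2) := by
        field_simp
        ring
    _ ≤ _ := by
        refine mul_le_mul_of_nonneg_left ?_ (by positivity)
        linarith

/-- The rate of jumps longer than `R` is bounded below uniformly in the step size `h ≤ H` and the
order `a ≤ αmax < 2`. Testing the symbol at frequencies `ξ` and `N ξ`: jumps of length at most `R`
contribute to `M_h(ξ)^{a/2}` at most a fraction of order `N^{-2}` of `M_h(N ξ)^{a/2} ≤ N^a
M_h(ξ)^{a/2}`, which is at most half of `M_h(ξ)^{a/2}` for `N` large because `a < 2`. The rest comes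
from long jumps. -/
theorem IsJumpKernel.exists_tail_lower_bound (p : Fin d) {αmax : ℝ} (hα : αmax < 2) {H R : ℝ}
    (hH : 0 < H) (hR : 0 < R) :
    ∃ τ : ℝ, 0 < τ ∧ ∀ h a κ : ℝ, ∀ w : (Fin d → ℤ) → ℝ, 0 < h → h ≤ H → 0 < a → a ≤ αmax →
      IsJumpKernel h a κ w →
        τ ≤ ∑' m, Set.indicator {m | R < |gridPoint h m p|} w m := by
  -- `N` makes `π² / 4 * N ^ (a - 2)`, the fraction due to short jumps, at most `1 / 2`
  obtain ⟨N, hN1, hN⟩ : ∃ N : ℕ, 1 ≤ N ∧ (N : ℝ) ^ (-(2 - αmax)) ≤ 2 / Real.pi ^ 2 := by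
    have ht : Tendsto (fun N : ℕ => (N : ℝ) ^ (-(2 - αmax))) atTop (𝓝 0) :=
      (tendsto_rpow_neg_atTop (by linarith)).comp tendsto_natCast_atTop_atTop
    have h1 := ht.eventually (ge_mem_nhds (by positivity : 0 < 2 / Real.pi ^ 2))
    obtain ⟨N, h2, h3⟩ := (h1.and (eventually_ge_atTop 1)).exists
    exact ⟨N, h3, h2⟩
  have hN0 : (1 : ℝ) ≤ N := by exact_mod_cast hN1
  have hpi := Real.pi_gt_three
  -- the frequency `t` along the axis `p` keeps the phases `N t x` of short jumps within `[-π, π]`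
  -- and lies in the frequency cube of every step size `h ≤ H`
  obtain ⟨t, ht0, htR, htH, ht1⟩ : ∃ t : ℝ, 0 < t ∧ N * t * R ≤ Real.pi ∧ t * H ≤ Real.pi ∧
      2 / Real.pi * t ≤ 1 := by
    refine ⟨min (1 / (N * R)) (min (1 / H) 1), by positivity, ?_, ?_, ?_⟩
    · calc N * min (1 / (N * R)) (min (1 / H) 1) * R ≤ N * (1 / (N * R)) * R := by
            gcongr; exact min_le_left _ _
        _ = 1 := by field_simp
        _ ≤ _ := by linarith
    · calc min (1 / (N * R)) (min (1 / H) 1) * H ≤ 1 / H * H := by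
            gcongr; exact (min_le_right _ _).trans (min_le_left _ _)
        _ = 1 := by field_simp
        _ ≤ _ := by linarith
    · calc 2 / Real.pi * min (1 / (N * R)) (min (1 / H) 1) ≤ 2 / Real.pi * 1 := by
            gcongr; exact (min_le_right _ _).trans (min_le_right _ _)
        _ ≤ 1 := by
            rw [mul_one, div_le_one (by positivity)]; linarith
  refine ⟨(2 / Real.pi * t) ^ 2 / 4, by positivity, fun h a κ w hh hhH ha haα hw => ?_⟩
  set F : Set (Fin d → ℤ) := {m | R < |gridPoint h m p|} with hF
  set ξ : EuclideanSpace ℝ (Fin d) := EuclideanSpace.single p t with hξ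
  have hinner : ∀ m, inner ℝ ξ (gridPoint h m) = t * gridPoint h m p := by
    intro m
    rw [hξ, EuclideanSpace.inner_single_left]
    simp
  have hwF : Summable (F.indicator w) := (hw.hasSum ha).summable.indicator F
  have hle : ∀ m, w m * (1 - Real.cos (inner ℝ ξ (gridPoint h m))) ≤ 2 * F.indicator w m +
      Real.pi ^ 2 / 4 / (N : ℝ) ^ 2 *
        (w m * (1 - Real.cos (inner ℝ ((N : ℝ) • ξ) (gridPoint h m)))) := by
    intro m
    have hnn : 0 ≤ Real.pi ^ 2 / 4 / (N : ℝ) ^ 2 *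
        (w m * (1 - Real.cos (inner ℝ ((N : ℝ) • ξ) (gridPoint h m)))) :=
      mul_nonneg (by positivity) (mul_nonneg (hw.nonneg m) (sub_nonneg.2 (Real.cos_le_one _)))
    by_cases hm : m ∈ F
    · rw [Set.indicator_of_mem hm]
      nlinarith [hw.nonneg m, Real.neg_one_le_cos (inner ℝ ξ (gridPoint h m))]
    · rw [Set.indicator_of_notMem hm, mul_zero, zero_add, mul_left_comm, inner_smul_left, hinner]
      refine mul_le_mul_of_nonneg_left (one_sub_cos_le_of_nat_mul hN1 ?_) (hw.nonneg m)
      have hm' : |gridPoint h m p| ≤ R := not_lt.1 hm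
      rw [← mul_assoc, abs_mul, abs_of_nonneg (by positivity : 0 ≤ (N : ℝ) * t)]
      exact (mul_le_mul_of_nonneg_left hm' (by positivity)).trans htR
  have hsum := hasSum_le hle (hw.hasSum_one_sub_cos ha ξ)
    ((hwF.hasSum.mul_left 2).add ((hw.hasSum_one_sub_cos ha ((N : ℝ) • ξ)).mul_left _))
  set M := multiplier h ξ with hM
  have hM0 : 0 ≤ M := multiplier_nonneg h ξ
  have hMN : multiplier h ((N : ℝ) • ξ) ^ (a / 2) ≤ (N : ℝ) ^ a * M ^ (a / 2) := by
    calc _ ≤ ((N : ℝ) ^ 2 * M) ^ (a / 2) := by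
          refine Real.rpow_le_rpow (multiplier_nonneg _ _) (multiplier_nat_smul_le h N ξ)
            (by linarith)
      _ = _ := by
          rw [Real.mul_rpow (by positivity) hM0, ← Real.rpow_natCast (N : ℝ) 2,
            ← Real.rpow_mul (by positivity)]
          congr 2
          push_cast
          ring
  have hNa : Real.pi ^ 2 / 4 / (N : ℝ) ^ 2 * (N : ℝ) ^ a ≤ 1 / 2 := by
    have h1 : (N : ℝ) ^ a / (N : ℝ) ^ 2 ≤ 2 / Real.pi ^ 2 := by
      rw [← Real.rpow_natCast (N : ℝ) 2, ← Real.rpow_sub (by linarith)]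
      refine le_trans (Real.rpow_le_rpow_of_exponent_le hN0 ?_) hN
      push_cast
      linarith
    calc _ = Real.pi ^ 2 / 4 * ((N : ℝ) ^ a / (N : ℝ) ^ 2) := by ring
      _ ≤ Real.pi ^ 2 / 4 * (2 / Real.pi ^ 2) := by gcongr
      _ = 1 / 2 := by field_simp; norm_num
  have hlow : (2 / Real.pi * t) ^ 2 ≤ M ^ (a / 2) := by
    have h1 : (2 / Real.pi * t) ^ 2 ≤ M :=
      sq_le_multiplier_single hh ht0.le ((mul_le_mul_of_nonneg_left hhH ht0.le).trans htH) p
    calc (2 / Real.pi * t) ^ 2 = (2 / Real.pi * t) ^ (2 : ℝ) := (Real.rpow_natCast _ 2).symm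
      _ ≤ (2 / Real.pi * t) ^ a :=
          Real.rpow_le_rpow_of_exponent_ge (by positivity) ht1 (by linarith)
      _ = ((2 / Real.pi * t) ^ 2) ^ (a / 2) := by
          rw [← Real.rpow_natCast _ 2, ← Real.rpow_mul (by positivity)]
          congr 1
          push_cast
          ring
      _ ≤ _ := Real.rpow_le_rpow (by positivity) h1 (by linarith)
  have hMa : 0 ≤ M ^ (a / 2) := Real.rpow_nonneg hM0 _
  have h3 : Real.pi ^ 2 / 4 / (N : ℝ) ^ 2 * multiplier h ((N : ℝ) • ξ) ^ (a / 2) ≤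
      1 / 2 * M ^ (a / 2) := by
    calc _ ≤ Real.pi ^ 2 / 4 / (N : ℝ) ^ 2 * ((N : ℝ) ^ a * M ^ (a / 2)) := by gcongr
      _ = Real.pi ^ 2 / 4 / (N : ℝ) ^ 2 * (N : ℝ) ^ a * M ^ (a / 2) := by ring
      _ ≤ _ := mul_le_mul_of_nonneg_right hNa hMa
  linarith

end Tail

/-! ### Stability and solvability of the scheme -/

section Stability

variable {d : ℕ}

theorem finite_gridPoint_mem {Ω : Set (EuclideanSpace ℝ (Fin d))} (hΩ : Bornology.IsBounded Ω)
    {h : ℝ} (hh : 0 < h) : {j : Fin d → ℤ | gridPoint h j ∈ Ω}.Finite := by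
  obtain ⟨R, hR⟩ := hΩ.subset_closedBall 0
  refine (Set.Finite.pi' fun _ : Fin d => Set.finite_Icc (-⌈R / h⌉) ⌈R / h⌉).subset
    fun j hj p => ?_
  have h1 : ‖gridPoint h j p‖ ≤ R :=
    (PiLp.norm_apply_le _ p).trans (by simpa using hR hj)
  rw [gridPoint_apply, Real.norm_eq_abs, abs_mul, abs_of_pos hh, ← le_div_iff₀ hh] at h1
  have h2 := abs_le.1 (h1.trans (Int.le_ceil _))
  exact ⟨by exact_mod_cast h2.1, by exact_mod_cast h2.2⟩

theorem gridNorm_nonneg (h : ℝ) (Ω : Set (EuclideanSpace ℝ (Fin d))) (v : (Fin d → ℤ) → ℝ) :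
    0 ≤ gridNorm h Ω v :=
  Real.iSup_nonneg fun _ => abs_nonneg _

theorem abs_le_gridNorm {Ω : Set (EuclideanSpace ℝ (Fin d))} (hΩ : Bornology.IsBounded Ω)
    {h : ℝ} (hh : 0 < h) (v : (Fin d → ℤ) → ℝ) {j : Fin d → ℤ} (hj : gridPoint h j ∈ Ω) :
    |v j| ≤ gridNorm h Ω v := by
  have : Finite {j : Fin d → ℤ // gridPoint h j ∈ Ω} := (finite_gridPoint_mem hΩ hh).to_subtype
  exact le_ciSup (f := fun j : {j : Fin d → ℤ // gridPoint h j ∈ Ω} => |v j|)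
    (Set.finite_range _).bddAbove ⟨j, hj⟩

theorem gridNorm_le {h : ℝ} {Ω : Set (EuclideanSpace ℝ (Fin d))} {v : (Fin d → ℤ) → ℝ} {B : ℝ}
    (hB : 0 ≤ B) (hv : ∀ j, gridPoint h j ∈ Ω → |v j| ≤ B) : gridNorm h Ω v ≤ B :=
  Real.iSup_le (fun j => hv j j.2) hB

/-- Discrete maximum principle: where `|v|` is maximal, the operator is bounded below by `|v|` times
the total weight `∑_{m ∈ F} wₘ` of the jumps that leave the support `S`. -/
theorem IsJumpKernel.tail_mul_abs_le {h a κ : ℝ} {w : (Fin d → ℤ) → ℝ}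
    (hw : IsJumpKernel h a κ w) (ha : 0 < a) {S : Finset (Fin d → ℤ)} {F : Set (Fin d → ℤ)}
    {j : Fin d → ℤ} (hF : ∀ k ∈ S, j - k ∉ F) {v : (Fin d → ℤ) → ℝ}
    (hv : ∀ k ∈ S, |v k| ≤ |v j|) {b : ℝ} (hb : 0 ≤ b) :
    (∑' m, F.indicator w m) * |v j| ≤ |κ * v j - ∑ k ∈ S, w (j - k) * v k + b * v j| := by
  have hs := (hw.hasSum ha).summable
  have hsplit : ∑ k ∈ S, w (j - k) + ∑' m, F.indicator w m ≤ κ := by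
    have h1 : ∑ k ∈ S, w (j - k) ≤ ∑' m, Fᶜ.indicator w m := by
      have : ∑ k ∈ S, w (j - k) = ∑ m ∈ S.map (Equiv.subLeft j).toEmbedding, Fᶜ.indicator w m := by
        rw [Finset.sum_map]
        refine Finset.sum_congr rfl fun k hk => ?_
        simp [Set.indicator_of_mem, hF k hk]
      rw [this]
      exact (hs.indicator _).sum_le_tsum _ fun m _ =>
        Set.indicator_nonneg (fun m _ => hw.nonneg m) m
    have h2 : ∑' m, Fᶜ.indicator w m + ∑' m, F.indicator w m = κ := by
      rw [← (hs.indicator _).tsum_add (hs.indicator _), ← (hw.hasSum ha).tsum_eq]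
      exact tsum_congr fun m => Set.indicator_compl_add_self_apply F w m
    linarith
  have hS : |∑ k ∈ S, w (j - k) * v k| ≤ (∑ k ∈ S, w (j - k)) * |v j| := by
    rw [Finset.sum_mul]
    refine (Finset.abs_sum_le_sum_abs _ _).trans (Finset.sum_le_sum fun k hk => ?_)
    rw [abs_mul, abs_of_nonneg (hw.nonneg _)]
    exact mul_le_mul_of_nonneg_left (hv k hk) (hw.nonneg _)
  have hκ : 0 ≤ κ := (hw.hasSum ha).nonneg hw.nonneg
  calc (∑' m, F.indicator w m) * |v j| ≤ (κ + b) * |v j| - (∑ k ∈ S, w (j - k)) * |v j| := by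
        nlinarith [abs_nonneg (v j)]
    _ ≤ |(κ + b) * v j| - |∑ k ∈ S, w (j - k) * v k| := by
        rw [abs_mul, abs_of_nonneg (add_nonneg hκ hb)]
        linarith
    _ ≤ |(κ + b) * v j - ∑ k ∈ S, w (j - k) * v k| := abs_sub_abs_le_abs_sub _ _
    _ = _ := by
        congr 1
        ring

/-- Every jump longer than the diameter of `Ω` leaves `Ω`, so the maximum principle applies with the
uniform lower bound for the rate of long jumps. -/
theorem exists_stability_const (hd : 1 ≤ d) {Ω : Set (EuclideanSpace ℝ (Fin d))}
    (hΩ : Bornology.IsBounded Ω) {αmin αmax : ℝ} (hαmin : 0 < αmin) (hαmax : αmax < 2) {H : ℝ}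
    (hH : 0 < H) :
    ∃ c : ℝ, 0 < c ∧ ∀ α b : EuclideanSpace ℝ (Fin d) → ℝ, IsOrder αmin αmax α →
      (∀ x ∈ Ω, 0 ≤ b x) → ∀ h : ℝ, 0 < h → h ≤ H → ∀ v g : (Fin d → ℤ) → ℝ,
        (∀ j, gridPoint h j ∈ Ω → discreteFracLaplacian h (α (gridPoint h j)) v j +
          ((b (gridPoint h j) * v j : ℝ) : ℂ) = ((g j : ℝ) : ℂ)) →
        (∀ j, gridPoint h j ∉ Ω → v j = 0) → gridNorm h Ω v ≤ c * gridNorm h Ω g := by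
  obtain ⟨R, hR0, hR⟩ := hΩ.subset_closedBall_lt 0 0
  obtain ⟨τ, hτ, htail⟩ := IsJumpKernel.exists_tail_lower_bound (⟨0, hd⟩ : Fin d) hαmax hH
    (by linarith : 0 < 2 * R)
  refine ⟨1 / τ, by positivity, fun α b hα hb h hh hhH v g heq hext => ?_⟩
  have hfin := finite_gridPoint_mem hΩ hh
  set S : Finset (Fin d → ℤ) := hfin.toFinset with hS
  have hmem : ∀ j, j ∈ S ↔ gridPoint h j ∈ Ω := by simp [hS]
  refine gridNorm_le (mul_nonneg (by positivity) (gridNorm_nonneg _ _ _)) fun i hi => ?_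
  obtain ⟨j, hjS, hj⟩ := S.exists_max_image (fun k => |v k|) ⟨i, (hmem i).2 hi⟩
  have hjΩ := (hmem j).1 hjS
  have hα0 : 0 < α (gridPoint h j) := hαmin.trans_le (hα.mem_Icc _).1
  have hα1 : α (gridPoint h j) ≤ αmax := (hα.mem_Icc _).2
  obtain ⟨κ, w, hw⟩ := exists_isJumpKernel (h := h) hd hα0 (by linarith)
  have e := heq j hjΩ
  rw [hw.discreteFracLaplacian_eq hα0 hh fun k hk => hext k (mt (hmem k).2 hk),
    ← Complex.ofReal_add, Complex.ofReal_inj] at e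
  have hfar : ∀ k ∈ S, j - k ∉ {m | 2 * R < |gridPoint h m (⟨0, hd⟩ : Fin d)|} := by
    intro k hk
    have h1 : ‖gridPoint h j‖ ≤ R := by simpa using hR hjΩ
    have h2 : ‖gridPoint h k‖ ≤ R := by simpa using hR ((hmem k).1 hk)
    refine not_lt.2 ((PiLp.norm_apply_le (gridPoint h (j - k)) _).trans ?_)
    rw [gridPoint_sub]
    exact (norm_sub_le _ _).trans (by linarith)
  have key := hw.tail_mul_abs_le hα0 hfar (v := v) (fun k hk => hj k hk) (hb _ hjΩ)
  rw [e] at key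
  have h3 := mul_le_mul_of_nonneg_right (htail h _ κ w hh hhH hα0 hα1 hw) (abs_nonneg (v j))
  have h4 := abs_le_gridNorm hΩ hh g hjΩ
  rw [div_mul_eq_mul_div, one_mul, le_div_iff₀ hτ, mul_comm]
  exact (mul_le_mul_of_nonneg_left (hj i ((hmem i).2 hi)) hτ.le).trans (by linarith)

theorem existsUnique_isSchemeSolution (hd : 1 ≤ d) {Ω : Set (EuclideanSpace ℝ (Fin d))}
    (hΩ : Bornology.IsBounded Ω) {αmin αmax : ℝ} (hαmin : 0 < αmin) (hαmax : αmax < 2)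
    {α b : EuclideanSpace ℝ (Fin d) → ℝ} (f : EuclideanSpace ℝ (Fin d) → ℝ)
    (hα : IsOrder αmin αmax α) (hb : ∀ x ∈ Ω, 0 ≤ b x) {h : ℝ} (hh : 0 < h) :
    ∃! v : (Fin d → ℤ) → ℝ, IsSchemeSolution h Ω α b f v := by
  obtain ⟨c, -, hc⟩ := exists_stability_const hd hΩ hαmin hαmax hh
  have hα0 : ∀ x, 0 < α x := fun x => hαmin.trans_le (hα.mem_Icc x).1
  have hα2 : ∀ x, α x ≤ 2 := fun x => (hα.mem_Icc x).2.trans hαmax.le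
  -- the homogeneous scheme has only the trivial solution
  have hinj : ∀ v : (Fin d → ℤ) → ℝ, (∀ j, gridPoint h j ∈ Ω →
      discreteFracLaplacian h (α (gridPoint h j)) v j + ((b (gridPoint h j) * v j : ℝ) : ℂ) = 0) →
      (∀ j, gridPoint h j ∉ Ω → v j = 0) → v = 0 := by
    intro v hv hv0
    have h1 := hc α b hα hb h hh le_rfl v 0 (by simpa using hv) hv0
    have h2 : gridNorm h Ω (0 : (Fin d → ℤ) → ℝ) ≤ 0 := gridNorm_le le_rfl (by simp)
    rw [le_antisymm h2 (gridNorm_nonneg _ _ _), mul_zero] at h1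
    funext j
    by_cases hj : gridPoint h j ∈ Ω
    · exact abs_nonpos_iff.1 ((abs_le_gridNorm hΩ hh v hj).trans h1)
    · exact hv0 j hj
  choose κ w hw using fun j : Fin d → ℤ =>
    exists_isJumpKernel (h := h) hd (hα0 (gridPoint h j)) (hα2 (gridPoint h j))
  have hfin := finite_gridPoint_mem hΩ hh
  set S : Finset (Fin d → ℤ) := hfin.toFinset with hS
  have hmem : ∀ j, j ∈ S ↔ gridPoint h j ∈ Ω := by simp [hS]
  let V : (S → ℝ) → (Fin d → ℤ) → ℝ := fun y k => if hk : k ∈ S then y ⟨k, hk⟩ else 0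
  have hV : ∀ y, ∀ k ∉ S, V y k = 0 := fun y k hk => dif_neg hk
  have hV' : ∀ (y : S → ℝ) (k : S), V y k = y k := fun y k => dif_pos k.2
  have hVext : ∀ y j, gridPoint h j ∉ Ω → V y j = 0 := fun y j hj => hV y j (mt (hmem j).1 hj)
  let T : (S → ℝ) →ₗ[ℝ] (S → ℝ) :=
    { toFun := fun y j => κ j * y j - ∑ k : S, w j (j - k) * y k + b (gridPoint h j) * y j
      map_add' := fun y z => by
        funext j
        simp only [Pi.add_apply, mul_add, Finset.sum_add_distrib]
        ring
      map_smul' := fun r y => by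
        funext j
        simp only [Pi.smul_apply, smul_eq_mul, RingHom.id_apply, mul_left_comm _ r,
          ← Finset.mul_sum]
        ring }
  have hT : ∀ (y : S → ℝ) (j : S), discreteFracLaplacian h (α (gridPoint h j)) (V y) j +
      ((b (gridPoint h j) * V y j : ℝ) : ℂ) = ((T y j : ℝ) : ℂ) := by
    intro y j
    rw [(hw j).discreteFracLaplacian_eq (hα0 _) hh (hV y), ← Complex.ofReal_add, hV',
      ← Finset.sum_coe_sort]
    simp only [hV']
    rfl
  have hTinj : Function.Injective T := by
    rw [← LinearMap.ker_eq_bot, LinearMap.ker_eq_bot']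
    intro y hy
    have := hinj (V y) (fun j hj => by simpa [hy] using hT y ⟨j, (hmem j).2 hj⟩) (hVext y)
    funext k
    rw [← hV' y k, this]
    rfl
  obtain ⟨y, hy⟩ := LinearMap.injective_iff_surjective.1 hTinj fun j => f (gridPoint h j)
  refine ⟨V y, ⟨fun j hj => ?_, hVext y⟩, fun v hv => ?_⟩
  · simpa [hy] using hT y ⟨j, (hmem j).2 hj⟩
  · have hvS : ∀ k ∉ S, v k = 0 := fun k hk => hv.exterior k (mt (hmem k).2 hk)
    rw [← sub_eq_zero]
    refine hinj _ (fun j hj => ?_) fun j hj => ?_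
    · have e1 := hv.equation j hj
      have e2 := hT y ⟨j, (hmem j).2 hj⟩
      rw [hy] at e2
      rw [(hw j).discreteFracLaplacian_eq (hα0 _) hh hvS] at e1
      rw [(hw j).discreteFracLaplacian_eq (hα0 _) hh (hV y)] at e2
      rw [(hw j).discreteFracLaplacian_eq (hα0 _) hh fun k hk => by
        rw [Pi.sub_apply, hvS k hk, hV y k hk, sub_zero]]
      rw [← sub_eq_zero.2 (e1.trans e2.symm)]
      simp only [Pi.sub_apply, mul_sub, Finset.sum_sub_distrib]
      push_cast
      ring
    · rw [Pi.sub_apply, hv.exterior j hj, hVext y j hj, sub_zero]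

end Stability

/-! ### The Fourier symbol of the fractional Laplacian -/

section KernelIntegral

theorem lintegral_ofReal_of_integral_eq {X : Type*} [MeasurableSpace X] {μ : Measure X}
    {f : X → ℝ} {c : ℝ} (hf : 0 ≤ᵐ[μ] f) (hc : 0 < c) (h : ∫ x, f x ∂μ = c) :
    ∫⁻ x, ENNReal.ofReal (f x) ∂μ = ENNReal.ofReal c := by
  have hint : Integrable f μ := Integrable.of_integral_ne_zero (by rw [h]; exact hc.ne')
  rw [← h, ofReal_integral_eq_lintegral_ofReal hint hf]

theorem integral_eq_of_lintegral_ofReal {X : Type*} [MeasurableSpace X] {μ : Measure X}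
    {f : X → ℝ} {c : ℝ} (hf : 0 ≤ᵐ[μ] f) (hm : AEStronglyMeasurable f μ) (hc : 0 ≤ c)
    (h : ∫⁻ x, ENNReal.ofReal (f x) ∂μ = ENNReal.ofReal c) :
    Integrable f μ ∧ ∫ x, f x ∂μ = c := by
  refine ⟨(lintegral_ofReal_ne_top_iff_integrable hm hf).1 (by rw [h]; exact ENNReal.ofReal_ne_top),
    ?_⟩
  rw [integral_eq_lintegral_of_nonneg_ae hf hm, h, ENNReal.toReal_ofReal hc]

/-- Write `1 - e^{-A y} = ∫₀ᴬ y e^{-r y} dr` and integrate in `y` first. -/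
theorem integral_rpow_mul_one_sub_exp {β A : ℝ} (hβ0 : 0 < β) (hβ1 : β < 1) (hA : 0 < A) :
    ∫ y in Set.Ioi (0 : ℝ), y ^ (-β - 1) * (1 - Real.exp (-(A * y))) =
      A ^ β * Real.Gamma (1 - β) / β := by
  have hΓ : 0 < Real.Gamma (1 - β) := Real.Gamma_pos_of_pos (by linarith)
  have hnn : 0 ≤ᵐ[volume.restrict (Set.Ioi (0 : ℝ))]
      fun y => y ^ (-β - 1) * (1 - Real.exp (-(A * y))) := by
    filter_upwards [ae_restrict_mem measurableSet_Ioi] with y (hy : 0 < y)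
    have : Real.exp (-(A * y)) ≤ 1 := Real.exp_le_one_iff.2 (by nlinarith)
    exact mul_nonneg (Real.rpow_nonneg hy.le _) (by linarith)
  refine (integral_eq_of_lintegral_ofReal hnn (by fun_prop) (by positivity) ?_).2
  have h1 : ∀ y ∈ Set.Ioi (0 : ℝ),
      ENNReal.ofReal (y ^ (-β - 1) * (1 - Real.exp (-(A * y)))) =
        ∫⁻ r in Set.Ioc 0 A, ENNReal.ofReal (y ^ (-β) * Real.exp (-(r * y))) := by
    intro y (hy : 0 < y)
    symm
    apply lintegral_ofReal_of_integral_eq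
    · exact ae_of_all _ fun r => by positivity
    · have : Real.exp (-(A * y)) < 1 := Real.exp_lt_one_iff.2 (by nlinarith)
      exact mul_pos (by positivity) (by linarith)
    · rw [← intervalIntegral.integral_of_le hA.le, intervalIntegral.integral_const_mul]
      have : ∀ r : ℝ, Real.exp (-(r * y)) = Real.exp (-y * r) := fun r => by ring_nf
      simp only [this]
      rw [intervalIntegral.integral_comp_mul_left (fun x => Real.exp x) (by linarith : -y ≠ 0),
        integral_exp, Real.rpow_sub_one hy.ne', smul_eq_mul]
      simp only [mul_zero, Real.exp_zero, neg_mul, mul_comm y A]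
      field_simp
      ring
  have h2 : ∀ r ∈ Set.Ioc 0 A,
      ∫⁻ y in Set.Ioi (0 : ℝ), ENNReal.ofReal (y ^ (-β) * Real.exp (-(r * y))) =
        ENNReal.ofReal (Real.Gamma (1 - β) * r ^ (β - 1)) := by
    intro r hr
    apply lintegral_ofReal_of_integral_eq
    · filter_upwards [ae_restrict_mem measurableSet_Ioi] with y (hy : 0 < y)
      change 0 ≤ y ^ (-β) * Real.exp (-(r * y))
      positivity
    · have := hr.1
      positivity
    · have := Real.integral_rpow_mul_exp_neg_mul_Ioi (a := 1 - β) (by linarith) hr.1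
      rw [show 1 - β - 1 = -β by ring] at this
      rw [this, one_div, Real.inv_rpow hr.1.le, ← Real.rpow_neg hr.1.le, neg_sub, mul_comm]
  rw [setLIntegral_congr_fun measurableSet_Ioi h1, lintegral_lintegral_swap (by fun_prop),
    setLIntegral_congr_fun measurableSet_Ioc h2]
  apply lintegral_ofReal_of_integral_eq
  · filter_upwards [ae_restrict_mem measurableSet_Ioc] with r hr
    have := hr.1
    change 0 ≤ Real.Gamma (1 - β) * r ^ (β - 1)
    positivity
  · positivity
  · rw [← intervalIntegral.integral_of_le hA.le, intervalIntegral.integral_const_mul,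
      integral_rpow (Or.inl (by linarith))]
    simp only [sub_add_cancel]
    rw [Real.zero_rpow hβ0.ne']
    ring

theorem integral_rpow_mul_one_sub_exp_div {β A : ℝ} (hβ0 : 0 < β) (hβ1 : β < 1) (hA : 0 < A) :
    ∫ t in Set.Ioi (0 : ℝ), t ^ (β - 1) * (1 - Real.exp (-(A / t))) =
      A ^ β * Real.Gamma (1 - β) / β := by
  rw [← integral_rpow_mul_one_sub_exp hβ0 hβ1 hA,
    -- the substitution `y = 1 / t`
    ← integral_comp_rpow_Ioi (fun y : ℝ => y ^ (-β - 1) * (1 - Real.exp (-(A * y))))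
      (p := -1) (by norm_num)]
  refine setIntegral_congr_fun measurableSet_Ioi fun t (ht : 0 < t) => ?_
  simp only [abs_neg, abs_one, one_mul, smul_eq_mul]
  rw [← mul_assoc, ← Real.rpow_mul ht.le, ← Real.rpow_add ht, Real.rpow_neg_one, div_eq_mul_inv]
  ring_nf

variable {d : ℕ}

theorem integral_gaussian_mul_one_sub_cos {t : ℝ} (ht : 0 < t) (ξ : EuclideanSpace ℝ (Fin d)) :
    ∫ z : EuclideanSpace ℝ (Fin d), Real.exp (-t * ‖z‖ ^ 2) * (1 - Real.cos (inner ℝ ξ z)) =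
      (Real.pi / t) ^ ((d : ℝ) / 2) * (1 - Real.exp (-(‖ξ‖ ^ 2 / 4 / t))) := by
  have ht' : 0 < (t : ℂ).re := ht
  have hi0 : Integrable fun z : EuclideanSpace ℝ (Fin d) => Real.exp (-t * ‖z‖ ^ 2) := by
    refine Integrable.of_integral_ne_zero ?_
    rw [GaussianFourier.integral_rexp_neg_mul_sq_norm ht]
    positivity
  have hpt : ∀ z : EuclideanSpace ℝ (Fin d),
      (Complex.exp (-t * ‖z‖ ^ 2 + Complex.I * ((inner ℝ ξ z : ℝ) : ℂ))).re =
        Real.exp (-t * ‖z‖ ^ 2) * Real.cos (inner ℝ ξ z) := by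
    intro z
    rw [Complex.exp_add, mul_comm Complex.I,
      show (-t * ‖z‖ ^ 2 : ℂ) = ((-t * ‖z‖ ^ 2 : ℝ) : ℂ) by push_cast; rfl, ← Complex.ofReal_exp,
      Complex.re_ofReal_mul, Complex.exp_ofReal_mul_I_re]
  have hc := GaussianFourier.integrable_cexp_neg_mul_sq_norm_add ht' Complex.I ξ
  have hi1 : Integrable fun z : EuclideanSpace ℝ (Fin d) =>
      Real.exp (-t * ‖z‖ ^ 2) * Real.cos (inner ℝ ξ z) := by
    refine hc.re.congr (ae_of_all _ fun z => ?_)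
    exact hpt z
  have h1 : ∫ z : EuclideanSpace ℝ (Fin d), Real.exp (-t * ‖z‖ ^ 2) * Real.cos (inner ℝ ξ z) =
      (Real.pi / t) ^ ((d : ℝ) / 2) * Real.exp (-(‖ξ‖ ^ 2 / 4 / t)) := by
    rw [← integral_congr_ae (ae_of_all _ hpt)]
    have h2 : ∫ z : EuclideanSpace ℝ (Fin d),
        (Complex.exp (-t * ‖z‖ ^ 2 + Complex.I * ((inner ℝ ξ z : ℝ) : ℂ))).re = _ :=
      integral_re hc
    rw [h2, GaussianFourier.integral_cexp_neg_mul_sq_norm_add ht', finrank_euclideanSpace_fin]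
    have e : ((Real.pi : ℂ) / t) ^ ((d : ℂ) / 2) *
        Complex.exp (Complex.I ^ 2 * (‖ξ‖ : ℂ) ^ 2 / (4 * t)) =
        (((Real.pi / t) ^ ((d : ℝ) / 2) * Real.exp (-(‖ξ‖ ^ 2 / 4 / t)) : ℝ) : ℂ) := by
      rw [Complex.ofReal_mul, Complex.ofReal_cpow (by positivity), Complex.ofReal_exp,
        Complex.I_sq]
      push_cast
      congr 2
      ring
    rw [e]
    exact Complex.ofReal_re _
  simp only [mul_sub, mul_one]
  rw [integral_sub hi0 hi1, h1, GaussianFourier.integral_rexp_neg_mul_sq_norm ht,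
    finrank_euclideanSpace_fin]

theorem fracConst_pos (d : ℕ) {a : ℝ} (ha0 : 0 < a) (ha2 : a < 2) : 0 < fracConst d a := by
  have h1 : 0 < Real.Gamma ((a + d) / 2) := Real.Gamma_pos_of_pos (by positivity)
  have h2 : 0 < Real.Gamma (1 - a / 2) := Real.Gamma_pos_of_pos (by linarith)
  unfold fracConst
  positivity

/-- The symbol of the fractional Laplacian. The power `|z|^{-d-a}` is a superposition of Gaussians
`e^{-t |z|²}`, whose Fourier transforms are known; Tonelli reduces the claim to a one-dimensional
Gamma integral. -/
theorem integral_one_sub_cos_div_norm_rpow {a : ℝ} (ha0 : 0 < a) (ha2 : a < 2)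
    (ξ : EuclideanSpace ℝ (Fin d)) :
    Integrable (fun z : EuclideanSpace ℝ (Fin d) =>
      (1 - Real.cos (inner ℝ ξ z)) / ‖z‖ ^ ((d : ℝ) + a)) ∧
    ∫ z : EuclideanSpace ℝ (Fin d), (1 - Real.cos (inner ℝ ξ z)) / ‖z‖ ^ ((d : ℝ) + a) =
      ‖ξ‖ ^ a / fracConst d a := by
  rcases eq_or_ne ξ 0 with rfl | hξ
  · simp [Real.zero_rpow ha0.ne']
  have hξ' : 0 < ‖ξ‖ := norm_pos_iff.2 hξ
  set p : ℝ := (a + d) / 2 with hp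
  have hp0 : 0 < p := by positivity
  have hΓ : 0 < Real.Gamma p := Real.Gamma_pos_of_pos hp0
  have hΓ1 : 0 < Real.Gamma (1 - a / 2) := Real.Gamma_pos_of_pos (by linarith)
  have hcos : ∀ z : EuclideanSpace ℝ (Fin d), 0 ≤ 1 - Real.cos (inner ℝ ξ z) := fun z =>
    sub_nonneg.2 (Real.cos_le_one _)
  set A : ℝ := ‖ξ‖ ^ 2 / 4 with hA
  have hA0 : 0 < A := by positivity
  have hC := fracConst_pos d ha0 ha2
  have hconst : (Real.Gamma p)⁻¹ *
      (Real.pi ^ ((d : ℝ) / 2) * (A ^ (a / 2) * Real.Gamma (1 - a / 2) / (a / 2))) =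
      ‖ξ‖ ^ a / fracConst d a := by
    have e1 : A ^ (a / 2) = ‖ξ‖ ^ a / 2 ^ a := by
      rw [hA, show ‖ξ‖ ^ 2 / 4 = (‖ξ‖ / 2) ^ (2 : ℝ) by rw [Real.rpow_two]; ring,
        ← Real.rpow_mul (by positivity), mul_div_cancel₀ a (two_ne_zero), Real.div_rpow
        (norm_nonneg _) (by norm_num)]
    rw [e1, fracConst, Real.rpow_sub_one (by norm_num), ← hp]
    field_simp
  rw [← hconst]
  refine integral_eq_of_lintegral_ofReal (ae_of_all _ fun z => div_nonneg (hcos z) (by positivity))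
    (Measurable.aestronglyMeasurable (by fun_prop)) (by positivity) ?_
  -- the power of the norm is a superposition of Gaussians
  have h1 : ∀ z : EuclideanSpace ℝ (Fin d),
      ENNReal.ofReal ((1 - Real.cos (inner ℝ ξ z)) / ‖z‖ ^ ((d : ℝ) + a)) =
      ∫⁻ t in Set.Ioi (0 : ℝ), ENNReal.ofReal ((Real.Gamma p)⁻¹ * (t ^ (p - 1) *
        (Real.exp (-t * ‖z‖ ^ 2) * (1 - Real.cos (inner ℝ ξ z))))) := by
    intro z
    -- at `z = 0` both sides vanish, since `1 - cos 0 = 0`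
    rcases eq_or_ne z 0 with rfl | hz
    · simp
    have hz' : 0 < ‖z‖ := norm_pos_iff.2 hz
    have hI := Real.integral_rpow_mul_exp_neg_mul_Ioi hp0 (by positivity : 0 < ‖z‖ ^ 2)
    have hint : IntegrableOn (fun t : ℝ => t ^ (p - 1) * Real.exp (-(‖z‖ ^ 2 * t)))
        (Set.Ioi 0) := by
      refine Integrable.of_integral_ne_zero ?_
      rw [hI]
      positivity
    have e : ∀ t : ℝ, (Real.Gamma p)⁻¹ * (t ^ (p - 1) *
        (Real.exp (-t * ‖z‖ ^ 2) * (1 - Real.cos (inner ℝ ξ z)))) =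
        (t ^ (p - 1) * Real.exp (-(‖z‖ ^ 2 * t))) *
          ((Real.Gamma p)⁻¹ * (1 - Real.cos (inner ℝ ξ z))) := by
      intro t
      rw [show -t * ‖z‖ ^ 2 = -(‖z‖ ^ 2 * t) by ring]
      ring
    simp only [e]
    rw [← ofReal_integral_eq_lintegral_ofReal (hint.mul_const _), integral_mul_const, hI]
    · congr 1
      rw [one_div, Real.inv_rpow (by positivity), ← Real.rpow_natCast ‖z‖ 2,
        ← Real.rpow_mul hz'.le, show ((2 : ℕ) : ℝ) * p = d + a by rw [hp]; push_cast; ring]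
      field_simp
    · filter_upwards [ae_restrict_mem measurableSet_Ioi] with t (ht : 0 < t)
      exact mul_nonneg (by positivity) (mul_nonneg (by positivity) (hcos z))
  have h2 : ∀ t ∈ Set.Ioi (0 : ℝ), ∫⁻ z : EuclideanSpace ℝ (Fin d),
      ENNReal.ofReal ((Real.Gamma p)⁻¹ * (t ^ (p - 1) *
        (Real.exp (-t * ‖z‖ ^ 2) * (1 - Real.cos (inner ℝ ξ z))))) =
      ENNReal.ofReal ((Real.Gamma p)⁻¹ *
        (Real.pi ^ ((d : ℝ) / 2) * (t ^ (a / 2 - 1) * (1 - Real.exp (-(A / t)))))) := by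
    intro t (ht : 0 < t)
    have hlt : Real.exp (-(A / t)) < 1 := Real.exp_lt_one_iff.2 (neg_neg_of_pos (by positivity))
    apply lintegral_ofReal_of_integral_eq
    · exact ae_of_all _ fun z => mul_nonneg (by positivity)
        (mul_nonneg (by positivity) (mul_nonneg (by positivity) (hcos z)))
    · have : 0 < 1 - Real.exp (-(A / t)) := by linarith
      positivity
    · rw [integral_const_mul, integral_const_mul, integral_gaussian_mul_one_sub_cos ht,
        Real.div_rpow Real.pi_pos.le ht.le,
        show a / 2 - 1 = p - 1 - (d : ℝ) / 2 by rw [hp]; ring, Real.rpow_sub ht (p - 1)]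
      ring
  simp only [h1]
  rw [lintegral_lintegral_swap, setLIntegral_congr_fun measurableSet_Ioi h2]
  · apply lintegral_ofReal_of_integral_eq
    · filter_upwards [ae_restrict_mem measurableSet_Ioi] with t (ht : 0 < t)
      have : Real.exp (-(A / t)) ≤ 1 := Real.exp_le_one_iff.2 (neg_nonpos.2 (by positivity))
      exact mul_nonneg (by positivity) (mul_nonneg (by positivity)
        (mul_nonneg (by positivity) (by linarith)))
    · positivity
    · rw [integral_const_mul, integral_const_mul,
        integral_rpow_mul_one_sub_exp_div (by positivity) (by linarith) hA0]
  · refine Measurable.aemeasurable ?_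
    unfold Function.uncurry
    fun_prop

end KernelIntegral

/-! ### Fourier multipliers on the Barron space -/

section Barron

variable {d : ℕ}

/-- The Fourier multiplier with symbol `σ` applied to `u`, evaluated at the point `x`:
`(2π)^{-d} ∫ e^{i ξ·x} σ(ξ) 𝓕[u](ξ) dξ`. -/
noncomputable def fourierMultiplier (σ u : EuclideanSpace ℝ (Fin d) → ℝ)
    (x : EuclideanSpace ℝ (Fin d)) : ℂ :=
  1 / (2 * (Real.pi : ℂ)) ^ d *
    ∫ ξ, Complex.exp (Complex.I * ((inner ℝ ξ x : ℝ) : ℂ)) * ((σ ξ : ℝ) : ℂ) * fourier u ξ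

theorem norm_exp_I_mul_ofReal (r : ℝ) : ‖Complex.exp (Complex.I * (r : ℂ))‖ = 1 := by
  rw [mul_comm, Complex.norm_exp_ofReal_mul_I]

theorem rpow_le_one_add_rpow {r a t : ℝ} (hr : 0 ≤ r) (ha : 0 ≤ a) (hat : a ≤ t) :
    r ^ a ≤ 1 + r ^ t := by
  rcases le_total r 1 with h | h
  · have := Real.rpow_le_one hr h ha
    have := Real.rpow_nonneg hr t
    linarith
  · have := Real.rpow_le_rpow_of_exponent_le h hat
    linarith

namespace MemBarron

variable {t : ℝ} {u : EuclideanSpace ℝ (Fin d) → ℝ}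

theorem continuous_fourier (hu : MemBarron t u) : Continuous (fourier u) := by
  refine continuous_of_dominated (bound := fun x => ‖u x‖) (fun ξ => ?_) (fun ξ => ?_)
    hu.integrable.norm ?_
  · have := hu.continuous
    exact Continuous.aestronglyMeasurable (by fun_prop)
  · refine ae_of_all _ fun x => ?_
    rw [norm_mul, norm_gridChar, one_mul, Complex.norm_real]
  · exact ae_of_all _ fun x => by fun_prop

theorem integrable_rpow_mul_fourier (hu : MemBarron t u) {a : ℝ} (ha : 0 ≤ a) (hat : a ≤ t) :
    Integrable fun ξ => ‖ξ‖ ^ a * ‖fourier u ξ‖ := by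
  have := hu.continuous_fourier
  refine hu.integrable_fourier.mono' (Continuous.aestronglyMeasurable ?_) (ae_of_all _ fun ξ => ?_)
  · exact (continuous_norm.rpow_const fun _ => Or.inr ha).mul this.norm
  · rw [Real.norm_of_nonneg (by positivity)]
    exact mul_le_mul_of_nonneg_right (rpow_le_one_add_rpow (norm_nonneg _) ha hat) (norm_nonneg _)

theorem integrable_transform (hu : MemBarron t u) (ht : 0 ≤ t) : Integrable (fourier u) := by
  have := hu.integrable_rpow_mul_fourier le_rfl ht
  simp only [Real.rpow_zero, one_mul] at this
  exact (integrable_norm_iff hu.continuous_fourier.aestronglyMeasurable).1 this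

theorem integrable_symbol_mul (hu : MemBarron t u) {a : ℝ} (ha : 0 ≤ a) (hat : a ≤ t)
    {σ : EuclideanSpace ℝ (Fin d) → ℝ} (hσ : Continuous σ) (hσa : ∀ ξ, |σ ξ| ≤ ‖ξ‖ ^ a)
    (x : EuclideanSpace ℝ (Fin d)) :
    Integrable fun ξ =>
      Complex.exp (Complex.I * ((inner ℝ ξ x : ℝ) : ℂ)) * ((σ ξ : ℝ) : ℂ) * fourier u ξ := by
  have := hu.continuous_fourier
  refine (hu.integrable_rpow_mul_fourier ha hat).mono'
    (Continuous.aestronglyMeasurable (by fun_prop)) (ae_of_all _ fun ξ => ?_)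
  rw [norm_mul, norm_mul, norm_exp_I_mul_ofReal, one_mul, Complex.norm_real]
  exact mul_le_mul_of_nonneg_right (hσa ξ) (norm_nonneg _)

/-- Fourier inversion. -/
theorem fourierMultiplier_one (hu : MemBarron t u) (ht : 0 ≤ t) (x : EuclideanSpace ℝ (Fin d)) :
    fourierMultiplier (fun _ => 1) u x = u x := by
  have hpi : (0 : ℝ) < 2 * Real.pi := by positivity
  have hF : ∀ η, FourierTransform.fourier (fun y => (u y : ℂ)) η =
      fourier u ((2 * Real.pi) • η) := by
    intro η
    rw [Real.fourier_eq', fourier]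
    refine integral_congr_ae (ae_of_all _ fun y => ?_)
    simp only [smul_eq_mul, inner_smul_left, real_inner_comm y η]
    congr 2
    simp
    ring
  have hFi : Integrable (FourierTransform.fourier fun y => (u y : ℂ)) :=
    ((hu.integrable_transform ht).comp_smul hpi.ne').congr (ae_of_all _ fun η => (hF η).symm)
  have hc : Continuous fun y => (u y : ℂ) := by
    have := hu.continuous
    fun_prop
  have key := congrFun (hc.fourierInv_fourier_eq hu.integrable.ofReal hFi) x
  rw [← key, Real.fourierInv_eq', fourierMultiplier]
  let G : EuclideanSpace ℝ (Fin d) → ℂ := fun ξ =>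
    Complex.exp (Complex.I * ((inner ℝ ξ x : ℝ) : ℂ)) * ((1 : ℝ) : ℂ) * fourier u ξ
  have e : ∀ η : EuclideanSpace ℝ (Fin d),
      Complex.exp (↑(2 * Real.pi * inner ℝ η x) * Complex.I) •
        FourierTransform.fourier (fun y => (u y : ℂ)) η = G ((2 * Real.pi) • η) := by
    intro η
    rw [hF, smul_eq_mul]
    simp [G, inner_smul_left, mul_comm]
  refine Eq.trans ?_ ((integral_congr_ae (ae_of_all _ e)).trans
    (Measure.integral_comp_smul volume G (2 * Real.pi))).symm
  rw [finrank_euclideanSpace_fin, abs_of_pos (by positivity), Complex.real_smul]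
  push_cast
  simp only [G, one_div, Complex.ofReal_one]

end MemBarron

end Barron

/-! ### The difference operator as a Fourier multiplier -/

section Consistency

variable {d : ℕ} {t h a κ : ℝ} {w : (Fin d → ℤ) → ℝ} {u : EuclideanSpace ℝ (Fin d) → ℝ}

theorem multiplier_le_norm_sq {h : ℝ} (hh : 0 < h) (ξ : EuclideanSpace ℝ (Fin d)) :
    multiplier h ξ ≤ ‖ξ‖ ^ 2 := by
  rw [EuclideanSpace.norm_sq_eq, multiplier]
  refine Finset.sum_le_sum fun p _ => ?_
  have := Real.sin_sq_le_sq (x := ξ p * h / 2)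
  calc 4 / h ^ 2 * Real.sin (ξ p * h / 2) ^ 2 ≤ 4 / h ^ 2 * (ξ p * h / 2) ^ 2 := by gcongr
    _ = _ := by
      rw [Real.norm_eq_abs, sq_abs]
      field_simp
      ring

theorem sq_sub_sin_sq_le (x : ℝ) : x ^ 2 - Real.sin x ^ 2 ≤ x ^ 4 := by
  wlog hx : 0 ≤ x generalizing x
  · simpa [Even.neg_pow (by decide : Even 4)] using this (-x) (by linarith)
  rcases le_total x 1 with h1 | h1
  · have h2 := Real.sin_ge_sub_cube hx
    have h3 := Real.sin_le hx
    have h4 : 0 ≤ x ^ 3 := by positivity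
    nlinarith [mul_nonneg hx h4]
  · nlinarith [sq_nonneg (Real.sin x), mul_nonneg hx hx, one_le_pow₀ h1 (n := 2)]

theorem norm_sq_sub_multiplier_le {h : ℝ} (hh : 0 < h) (ξ : EuclideanSpace ℝ (Fin d)) :
    ‖ξ‖ ^ 2 - multiplier h ξ ≤ h ^ 2 * ‖ξ‖ ^ 4 := by
  have h1 : ∀ p : Fin d, ‖ξ p‖ ^ 2 - 4 / h ^ 2 * Real.sin (ξ p * h / 2) ^ 2 ≤
      h ^ 2 * ‖ξ‖ ^ 2 * ‖ξ p‖ ^ 2 := by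
    intro p
    have h2 := sq_sub_sin_sq_le (ξ p * h / 2)
    have h3 : ‖ξ p‖ ^ 2 ≤ ‖ξ‖ ^ 2 :=
      pow_le_pow_left₀ (norm_nonneg _) (PiLp.norm_apply_le ξ p) 2
    have h4 : ‖ξ p‖ ^ 2 = ξ p ^ 2 := by rw [Real.norm_eq_abs, sq_abs]
    calc ‖ξ p‖ ^ 2 - 4 / h ^ 2 * Real.sin (ξ p * h / 2) ^ 2
        = 4 / h ^ 2 * ((ξ p * h / 2) ^ 2 - Real.sin (ξ p * h / 2) ^ 2) := by
          rw [h4]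
          field_simp
          ring
      _ ≤ 4 / h ^ 2 * (ξ p * h / 2) ^ 4 := by gcongr
      _ = h ^ 2 * ‖ξ p‖ ^ 2 * ‖ξ p‖ ^ 2 / 4 := by
          rw [h4]
          field_simp
          ring
      _ ≤ h ^ 2 * ‖ξ p‖ ^ 2 * ‖ξ p‖ ^ 2 := div_le_self (by positivity) (by norm_num)
      _ ≤ _ := by gcongr
  calc ‖ξ‖ ^ 2 - multiplier h ξ
      = ∑ p, (‖ξ p‖ ^ 2 - 4 / h ^ 2 * Real.sin (ξ p * h / 2) ^ 2) := by
        rw [EuclideanSpace.norm_sq_eq, multiplier, Finset.sum_sub_distrib]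
    _ ≤ ∑ p, h ^ 2 * ‖ξ‖ ^ 2 * ‖ξ p‖ ^ 2 := Finset.sum_le_sum fun p _ => h1 p
    _ = h ^ 2 * ‖ξ‖ ^ 4 := by
        rw [← Finset.mul_sum, ← EuclideanSpace.norm_sq_eq]
        ring

theorem multiplier_rpow_le (hh : 0 < h) (ha : 0 ≤ a) (ξ : EuclideanSpace ℝ (Fin d)) :
    multiplier h ξ ^ (a / 2) ≤ ‖ξ‖ ^ a := by
  calc multiplier h ξ ^ (a / 2) ≤ (‖ξ‖ ^ 2) ^ (a / 2) :=
        Real.rpow_le_rpow (multiplier_nonneg h ξ) (multiplier_le_norm_sq hh ξ) (by linarith)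
    _ = ‖ξ‖ ^ a := by
        rw [← Real.rpow_natCast ‖ξ‖ 2, ← Real.rpow_mul (norm_nonneg _)]
        congr 1
        push_cast
        ring

/-- With `q = M_h(ξ) / |ξ|² ∈ [0, 1]`, `1 - q^{a/2} ≤ 1 - q ≤ (1 - q)^{s/2}` and `1 - q ≤ (h |ξ|)²`.
-/
theorem norm_rpow_sub_multiplier_rpow_le {s : ℝ} (hh : 0 < h) (ha0 : 0 < a) (ha2 : a ≤ 2)
    (hs0 : 0 < s) (hs2 : s ≤ 2) (ξ : EuclideanSpace ℝ (Fin d)) :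
    ‖ξ‖ ^ a - multiplier h ξ ^ (a / 2) ≤ h ^ s * ‖ξ‖ ^ (s + a) := by
  rcases eq_or_ne ξ 0 with rfl | hξ
  · simp [Real.zero_rpow ha0.ne', Real.zero_rpow (by linarith : s + a ≠ 0),
      Real.zero_rpow (by linarith : a / 2 ≠ 0)]
  have hξ' : 0 < ‖ξ‖ := norm_pos_iff.2 hξ
  set q := multiplier h ξ / ‖ξ‖ ^ 2 with hq
  have hq0 : 0 ≤ q := div_nonneg (multiplier_nonneg h ξ) (by positivity)
  have hq1 : q ≤ 1 := (div_le_one (by positivity)).2 (multiplier_le_norm_sq hh ξ)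
  have hM : multiplier h ξ = ‖ξ‖ ^ 2 * q := by rw [hq]; field_simp
  have e1 : (‖ξ‖ ^ 2) ^ (a / 2) = ‖ξ‖ ^ a := by
    rw [← Real.rpow_natCast ‖ξ‖ 2, ← Real.rpow_mul (norm_nonneg _)]
    congr 1
    push_cast
    ring
  have hqle : q ≤ q ^ (a / 2) := by
    simpa using Real.rpow_le_rpow_of_exponent_ge' hq0 hq1 (by linarith : 0 ≤ a / 2)
      (by linarith : a / 2 ≤ 1)
  have h1q : 1 - q ≤ (h * ‖ξ‖) ^ 2 := by
    have := norm_sq_sub_multiplier_le hh ξ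
    rw [hM] at this
    have h2 : ‖ξ‖ ^ 2 * (1 - q) ≤ ‖ξ‖ ^ 2 * (h * ‖ξ‖) ^ 2 := by nlinarith
    exact le_of_mul_le_mul_left h2 (by positivity)
  have h2q : 1 - q ≤ (h * ‖ξ‖) ^ s := by
    calc 1 - q ≤ (1 - q) ^ (s / 2) := by
          simpa using Real.rpow_le_rpow_of_exponent_ge' (by linarith : 0 ≤ 1 - q) (by linarith)
            (by linarith : 0 ≤ s / 2) (by linarith : s / 2 ≤ 1)
      _ ≤ ((h * ‖ξ‖) ^ 2) ^ (s / 2) := Real.rpow_le_rpow (by linarith) h1q (by linarith)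
      _ = (h * ‖ξ‖) ^ s := by
          rw [← Real.rpow_natCast _ 2, ← Real.rpow_mul (by positivity)]
          congr 1
          push_cast
          ring
  calc ‖ξ‖ ^ a - multiplier h ξ ^ (a / 2) = ‖ξ‖ ^ a * (1 - q ^ (a / 2)) := by
        rw [hM, Real.mul_rpow (by positivity) hq0, e1]
        ring
    _ ≤ ‖ξ‖ ^ a * (h * ‖ξ‖) ^ s := by
        gcongr
        linarith
    _ = h ^ s * ‖ξ‖ ^ (s + a) := by
        rw [Real.mul_rpow hh.le hξ'.le, Real.rpow_add hξ']
        ring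

/-- The symbol `M_h` is `2π/h`-periodic, so no aliasing occurs: on samples of `u` the difference
operator acts as the multiplier `M_h^{a/2}` over the whole frequency space. -/
theorem IsJumpKernel.sum_eq_fourierMultiplier (hw : IsJumpKernel h a κ w) (ha : 0 < a)
    (hat : a ≤ t) (hh : 0 < h) (hu : MemBarron t u) {S : Finset (Fin d → ℤ)}
    (hS : ∀ k ∉ S, u (gridPoint h k) = 0) (j : Fin d → ℤ) :
    ((κ * u (gridPoint h j) - ∑ k ∈ S, w (j - k) * u (gridPoint h k) : ℝ) : ℂ) =
      fourierMultiplier (fun ξ => multiplier h ξ ^ (a / 2)) u (gridPoint h j) := by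
  have ht : 0 ≤ t := ha.le.trans hat
  have hinv : ∀ x, (u x : ℂ) = 1 / (2 * (Real.pi : ℂ)) ^ d *
      ∫ ξ, Complex.exp (Complex.I * ((inner ℝ ξ x : ℝ) : ℂ)) * fourier u ξ := by
    intro x
    rw [← hu.fourierMultiplier_one ht x, fourierMultiplier]
    simp
  have hint : ∀ x, Integrable fun ξ =>
      Complex.exp (Complex.I * ((inner ℝ ξ x : ℝ) : ℂ)) * fourier u ξ := by
    intro x
    simpa using hu.integrable_symbol_mul le_rfl ht (σ := fun _ => 1) continuous_const (by simp) x
  have hMint := hu.integrable_symbol_mul ha.le hat (continuous_multiplier_rpow h ha.le)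
    (fun ξ => by
      rw [abs_of_nonneg (Real.rpow_nonneg (multiplier_nonneg h ξ) _)]
      exact multiplier_rpow_le hh ha.le ξ) (gridPoint h j)
  have hsum : ∀ ξ, HasSum (fun m => (w m : ℂ) *
      (Complex.exp (Complex.I * ((inner ℝ ξ (gridPoint h (j - m)) : ℝ) : ℂ)) * fourier u ξ))
      (κ * (Complex.exp (Complex.I * ((inner ℝ ξ (gridPoint h j) : ℝ) : ℂ)) * fourier u ξ) -
        Complex.exp (Complex.I * ((inner ℝ ξ (gridPoint h j) : ℝ) : ℂ)) *
          ((multiplier h ξ ^ (a / 2) : ℝ) : ℂ) * fourier u ξ) := by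
    intro ξ
    convert! (hw.hasSum_char ξ).mul_left
      (Complex.exp (Complex.I * ((inner ℝ ξ (gridPoint h j) : ℝ) : ℂ)) * fourier u ξ) using 1
    · funext m
      rw [gridPoint_sub, inner_sub_right, Complex.ofReal_sub, mul_sub, sub_eq_add_neg,
        Complex.exp_add]
      ring
    · push_cast
      ring
  have key := hasSum_integral_of_summable_integral_norm (μ := volume)
    (F := fun m ξ => (w m : ℂ) *
      (Complex.exp (Complex.I * ((inner ℝ ξ (gridPoint h (j - m)) : ℝ) : ℂ)) * fourier u ξ))
    (fun m => (hint _).const_mul _) (by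
      simp only [norm_mul, norm_exp_I_mul_ofReal, one_mul, Complex.norm_real,
        Real.norm_of_nonneg (hw.nonneg _), integral_const_mul]
      exact (hw.hasSum ha).summable.mul_right _)
  simp only [(hsum _).tsum_eq] at key
  rw [integral_sub ((hint _).const_mul _) hMint, integral_const_mul] at key
  have key2 := key.mul_left (1 / (2 * (Real.pi : ℂ)) ^ d)
  simp only [integral_const_mul, mul_left_comm _ (w _ : ℂ), ← hinv] at key2
  rw [mul_sub, mul_left_comm, ← hinv] at key2
  have h1 : HasSum (fun k => (w (j - k) : ℂ) * (u (gridPoint h k) : ℂ))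
      (∑ k ∈ S, (w (j - k) : ℂ) * (u (gridPoint h k) : ℂ)) :=
    hasSum_sum_of_ne_finset_zero fun k hk => by rw [hS k hk]; simp
  have h2 := (Equiv.subLeft j).hasSum_iff.2 key2
  simp only [Function.comp_def, Equiv.subLeft_apply, sub_sub_cancel] at h2
  have h3 := h1.unique h2
  push_cast
  rw [h3, fourierMultiplier]
  ring

end Consistency

/-! ### The principal value as a Fourier multiplier -/

section PrincipalValue

variable {d : ℕ} {t a : ℝ} {u : EuclideanSpace ℝ (Fin d) → ℝ}

/-- The kernel `|z|^{-d-a}` with the ball of radius `ε` cut out. -/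
noncomputable def truncKernel (d : ℕ) (a ε : ℝ) : EuclideanSpace ℝ (Fin d) → ℝ :=
  Set.indicator {z | ε < ‖z‖} fun z => (‖z‖ ^ ((d : ℝ) + a))⁻¹

theorem truncKernel_nonneg (a ε : ℝ) (z : EuclideanSpace ℝ (Fin d)) :
    0 ≤ truncKernel d a ε z :=
  Set.indicator_nonneg (fun z _ => by positivity) z

theorem truncKernel_le (a ε : ℝ) (z : EuclideanSpace ℝ (Fin d)) :
    truncKernel d a ε z ≤ (‖z‖ ^ ((d : ℝ) + a))⁻¹ :=
  Set.indicator_le_self' (fun z _ => by positivity) z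

theorem truncKernel_neg (a ε : ℝ) (z : EuclideanSpace ℝ (Fin d)) :
    truncKernel d a ε (-z) = truncKernel d a ε z := by
  simp [truncKernel, Set.indicator_apply]

theorem measurable_truncKernel (a ε : ℝ) : Measurable (truncKernel d a ε) :=
  Measurable.indicator (by fun_prop) (measurableSet_lt measurable_const measurable_norm)

theorem integrable_truncKernel (ha : 0 < a) {ε : ℝ} (hε : 0 < ε) :
    Integrable (truncKernel d a ε) := by
  have h1 : Integrable fun z : EuclideanSpace ℝ (Fin d) => (1 + ‖z‖) ^ (-((d : ℝ) + a)) :=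
    integrable_one_add_norm (by rw [finrank_euclideanSpace_fin]; linarith)
  refine (h1.const_mul ((1 / ε + 1) ^ ((d : ℝ) + a))).mono'
    (measurable_truncKernel a ε).aestronglyMeasurable (ae_of_all _ fun z => ?_)
  rw [Real.norm_of_nonneg (truncKernel_nonneg a ε z)]
  by_cases hz : ε < ‖z‖
  · have hz0 : 0 < ‖z‖ := hε.trans hz
    have hle : 1 + ‖z‖ ≤ (1 / ε + 1) * ‖z‖ := by
      have : 1 ≤ 1 / ε * ‖z‖ := by
        rw [div_mul_eq_mul_div, one_mul, le_div_iff₀ hε]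
        linarith
      linarith
    have h2 : (1 + ‖z‖) ^ ((d : ℝ) + a) ≤ (1 / ε + 1) ^ ((d : ℝ) + a) * ‖z‖ ^ ((d : ℝ) + a) := by
      rw [← Real.mul_rpow (by positivity) hz0.le]
      exact Real.rpow_le_rpow (by positivity) hle (by positivity)
    rw [truncKernel, Set.indicator_of_mem (by exact hz), Real.rpow_neg (by positivity),
      ← div_eq_mul_inv, inv_eq_one_div, div_le_div_iff₀ (by positivity) (by positivity), one_mul]
    exact h2
  · rw [truncKernel, Set.indicator_of_notMem (by exact hz)]
    positivity

/-- The sine part of the exponential is odd and drops out. -/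
theorem integral_truncKernel_mul_one_sub_exp (ha : 0 < a) {ε : ℝ} (hε : 0 < ε)
    (ξ : EuclideanSpace ℝ (Fin d)) :
    ∫ z, (truncKernel d a ε z : ℂ) * (1 - Complex.exp (-(Complex.I * ((inner ℝ ξ z : ℝ) : ℂ)))) =
      ((∫ z, truncKernel d a ε z * (1 - Real.cos (inner ℝ ξ z)) : ℝ) : ℂ) := by
  have hk := integrable_truncKernel (d := d) ha hε
  have hi : ∀ g : EuclideanSpace ℝ (Fin d) → ℝ, Continuous g → (∀ z, |g z| ≤ 2) →
      Integrable fun z => truncKernel d a ε z * g z := by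
    intro g hg hg2
    refine (hk.mul_const 2).mono' (hk.aestronglyMeasurable.mul hg.aestronglyMeasurable)
      (ae_of_all _ fun z => ?_)
    rw [norm_mul, Real.norm_of_nonneg (truncKernel_nonneg a ε z)]
    exact mul_le_mul_of_nonneg_left (hg2 z) (truncKernel_nonneg a ε z)
  have hi1 := hi (fun z => 1 - Real.cos (inner ℝ ξ z)) (by fun_prop) fun z => by
    rw [abs_of_nonneg (sub_nonneg.2 (Real.cos_le_one _))]
    linarith [Real.neg_one_le_cos (inner ℝ ξ z)]
  have hi2 := hi (fun z => Real.sin (inner ℝ ξ z)) (by fun_prop) fun z =>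
    (Real.abs_sin_le_one _).trans one_le_two
  have hodd : ∫ z, truncKernel d a ε z * Real.sin (inner ℝ ξ z) = 0 := by
    have := integral_neg_eq_self (fun z => truncKernel d a ε z * Real.sin (inner ℝ ξ z)) volume
    simp only [truncKernel_neg, inner_neg_right, Real.sin_neg, mul_neg, integral_neg] at this
    linarith
  have e : ∀ z, (truncKernel d a ε z : ℂ) *
      (1 - Complex.exp (-(Complex.I * ((inner ℝ ξ z : ℝ) : ℂ)))) =
      ((truncKernel d a ε z * (1 - Real.cos (inner ℝ ξ z)) : ℝ) : ℂ) +
        Complex.I * ((truncKernel d a ε z * Real.sin (inner ℝ ξ z) : ℝ) : ℂ) := by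
    intro z
    rw [mul_comm Complex.I, ← neg_mul, ← Complex.ofReal_neg, Complex.exp_mul_I,
      ← Complex.ofReal_cos, ← Complex.ofReal_sin, Real.cos_neg, Real.sin_neg]
    push_cast
    ring
  simp only [e]
  rw [integral_add hi1.ofReal (hi2.ofReal.const_mul _), integral_const_mul, integral_complex_ofReal,
    integral_complex_ofReal, hodd]
  simp

theorem tendsto_integral_truncKernel (ha0 : 0 < a) (ha2 : a < 2)
    (ξ : EuclideanSpace ℝ (Fin d)) :
    Tendsto (fun ε : ℝ => ∫ z, truncKernel d a ε z * (1 - Real.cos (inner ℝ ξ z))) (𝓝[>] 0)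
      (𝓝 (‖ξ‖ ^ a / fracConst d a)) := by
  obtain ⟨hint, hval⟩ := integral_one_sub_cos_div_norm_rpow ha0 ha2 ξ
  have hcos : ∀ z : EuclideanSpace ℝ (Fin d), 0 ≤ 1 - Real.cos (inner ℝ ξ z) := fun z =>
    sub_nonneg.2 (Real.cos_le_one _)
  rw [← hval]
  refine tendsto_integral_filter_of_dominated_convergence _ (Eventually.of_forall fun ε => ?_)
    (Eventually.of_forall fun ε => ae_of_all _ fun z => ?_) hint (ae_of_all _ fun z => ?_)
  · exact ((measurable_truncKernel a ε).mul (by fun_prop)).aestronglyMeasurable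
  · rw [Real.norm_of_nonneg (mul_nonneg (truncKernel_nonneg a ε z) (hcos z)), mul_comm,
      div_eq_mul_inv]
    exact mul_le_mul_of_nonneg_left (truncKernel_le a ε z) (hcos z)
  · rcases eq_or_ne z 0 with rfl | hz
    · simp
    refine tendsto_const_nhds.congr' ?_
    filter_upwards [Ioo_mem_nhdsGT (norm_pos_iff.2 hz)] with ε hε
    rw [truncKernel, Set.indicator_of_mem (by exact hε.2), mul_comm, div_eq_mul_inv]

theorem integral_truncKernel_le (ha0 : 0 < a) (ha2 : a < 2) (ε : ℝ)
    (ξ : EuclideanSpace ℝ (Fin d)) :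
    ∫ z, truncKernel d a ε z * (1 - Real.cos (inner ℝ ξ z)) ≤ ‖ξ‖ ^ a / fracConst d a := by
  obtain ⟨hint, hval⟩ := integral_one_sub_cos_div_norm_rpow ha0 ha2 ξ
  have hcos : ∀ z : EuclideanSpace ℝ (Fin d), 0 ≤ 1 - Real.cos (inner ℝ ξ z) := fun z =>
    sub_nonneg.2 (Real.cos_le_one _)
  rw [← hval]
  refine integral_mono_of_nonneg
    (ae_of_all _ fun z => mul_nonneg (truncKernel_nonneg a ε z) (hcos z)) hint
    (ae_of_all _ fun z => ?_)
  change truncKernel d a ε z * _ ≤ _ / _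
  rw [mul_comm, div_eq_mul_inv]
  exact mul_le_mul_of_nonneg_left (truncKernel_le a ε z) (hcos z)

/-- Fubini is available because the truncated kernel is integrable. -/
theorem MemBarron.truncated_integral_eq (hu : MemBarron t u) (ht : 0 ≤ t) (ha : 0 < a)
    {ε : ℝ} (hε : 0 < ε) (x : EuclideanSpace ℝ (Fin d)) :
    ((∫ y in {y | ε < ‖x - y‖}, (u x - u y) / ‖x - y‖ ^ ((d : ℝ) + a) : ℝ) : ℂ) =
      fourierMultiplier
        (fun ξ => ∫ z, truncKernel d a ε z * (1 - Real.cos (inner ℝ ξ z))) u x := by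
  have hinv : ∀ x, (u x : ℂ) = 1 / (2 * (Real.pi : ℂ)) ^ d *
      ∫ ξ, Complex.exp (Complex.I * ((inner ℝ ξ x : ℝ) : ℂ)) * fourier u ξ := by
    intro x
    rw [← hu.fourierMultiplier_one ht x, fourierMultiplier]
    simp
  have hint : ∀ x, Integrable fun ξ =>
      Complex.exp (Complex.I * ((inner ℝ ξ x : ℝ) : ℂ)) * fourier u ξ := by
    intro x
    simpa using hu.integrable_symbol_mul le_rfl ht (σ := fun _ => 1) continuous_const (by simp) x
  have hk := integrable_truncKernel (d := d) ha hε
  set Φ : EuclideanSpace ℝ (Fin d) → EuclideanSpace ℝ (Fin d) → ℂ := fun z ξ =>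
    (truncKernel d a ε z : ℂ) * ((1 - Complex.exp (-(Complex.I * ((inner ℝ ξ z : ℝ) : ℂ)))) *
      (Complex.exp (Complex.I * ((inner ℝ ξ x : ℝ) : ℂ)) * fourier u ξ)) with hΦ
  have hΦint : Integrable (Function.uncurry Φ) (volume.prod volume) := by
    have hb := (hk.mul_const 2).mul_prod (hu.integrable_transform ht).norm
    have hf := hu.continuous_fourier.measurable
    have hm := measurable_truncKernel (d := d) a ε
    refine hb.mono' (Measurable.aestronglyMeasurable ?_) (ae_of_all _ fun q => ?_)
    · rw [hΦ]
      unfold Function.uncurry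
      fun_prop
    · simp only [Function.uncurry, hΦ]
      rw [norm_mul, norm_mul, norm_mul, norm_exp_I_mul_ofReal, one_mul, Complex.norm_real,
        Real.norm_of_nonneg (truncKernel_nonneg a ε _), mul_assoc]
      refine mul_le_mul_of_nonneg_left (mul_le_mul_of_nonneg_right ?_ (norm_nonneg _))
        (truncKernel_nonneg a ε _)
      refine (norm_sub_le _ _).trans ?_
      rw [norm_gridChar, norm_one]
      norm_num
  -- the substitution `y = x - z`
  have h1 : ∫ y in {y | ε < ‖x - y‖}, (u x - u y) / ‖x - y‖ ^ ((d : ℝ) + a) =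
      ∫ z, truncKernel d a ε z * (u x - u (x - z)) := by
    rw [← integral_sub_left_eq_self _ volume x, ← integral_indicator
      (measurableSet_lt measurable_const (by fun_prop))]
    refine integral_congr_ae (ae_of_all _ fun y => ?_)
    simp only [truncKernel, Set.indicator_apply, Set.mem_ofPred_eq, sub_sub_cancel]
    split_ifs
    · rw [mul_comm, div_eq_mul_inv]
    · rw [zero_mul]
  have h2 : ∀ z, ((truncKernel d a ε z * (u x - u (x - z)) : ℝ) : ℂ) =
      1 / (2 * (Real.pi : ℂ)) ^ d * ∫ ξ, Φ z ξ := by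
    intro z
    rw [Complex.ofReal_mul, Complex.ofReal_sub, hinv x, hinv (x - z), ← mul_sub,
      ← integral_sub (hint _) (hint _), mul_left_comm, ← integral_const_mul]
    congr 1
    refine integral_congr_ae (ae_of_all _ fun ξ => ?_)
    have e : Complex.exp (Complex.I * ((inner ℝ ξ (x - z) : ℝ) : ℂ)) =
        Complex.exp (Complex.I * ((inner ℝ ξ x : ℝ) : ℂ)) *
          Complex.exp (-(Complex.I * ((inner ℝ ξ z : ℝ) : ℂ))) := by
      rw [inner_sub_right, Complex.ofReal_sub, mul_sub, sub_eq_add_neg, Complex.exp_add]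
    simp only [hΦ, e]
    ring
  rw [h1, ← integral_complex_ofReal, integral_congr_ae (ae_of_all _ h2), integral_const_mul,
    integral_integral_swap hΦint, fourierMultiplier]
  congr 1
  refine integral_congr_ae (ae_of_all _ fun ξ => ?_)
  simp only [hΦ, ← mul_assoc]
  rw [integral_mul_const, integral_mul_const, integral_truncKernel_mul_one_sub_exp ha hε]
  ring

/-- Dominated convergence in frequency space, with majorant `|ξ|^a |𝓕[u](ξ)|`, identifies the
principal value. -/
theorem HasFracLaplacianAt.eq_fourierMultiplier (ha0 : 0 < a) (ha2 : a < 2) (hat : a ≤ t)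
    (hu : MemBarron t u) {x : EuclideanSpace ℝ (Fin d)} {l : ℝ}
    (hl : HasFracLaplacianAt a u x l) :
    (l : ℂ) = fourierMultiplier (fun ξ => ‖ξ‖ ^ a) u x := by
  have ht : 0 ≤ t := ha0.le.trans hat
  have hC := fracConst_pos d ha0 ha2
  have hcos : ∀ ξ z : EuclideanSpace ℝ (Fin d), 0 ≤ 1 - Real.cos (inner ℝ ξ z) := fun ξ z =>
    sub_nonneg.2 (Real.cos_le_one _)
  have hlim : Tendsto (fun ε : ℝ => ∫ ξ, Complex.exp (Complex.I * ((inner ℝ ξ x : ℝ) : ℂ)) *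
      ((∫ z, truncKernel d a ε z * (1 - Real.cos (inner ℝ ξ z)) : ℝ) : ℂ) * fourier u ξ) (𝓝[>] 0)
      (𝓝 (∫ ξ, Complex.exp (Complex.I * ((inner ℝ ξ x : ℝ) : ℂ)) *
        ((‖ξ‖ ^ a / fracConst d a : ℝ) : ℂ) * fourier u ξ)) := by
    refine tendsto_integral_filter_of_dominated_convergence
      (fun ξ => (fracConst d a)⁻¹ * (‖ξ‖ ^ a * ‖fourier u ξ‖)) ?_
      (Eventually.of_forall fun ε => ae_of_all _ fun ξ => ?_)
      ((hu.integrable_rpow_mul_fourier ha0.le hat).const_mul _) (ae_of_all _ fun ξ => ?_)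
    · filter_upwards [self_mem_nhdsWithin] with ε (hε : 0 < ε)
      have hk := integrable_truncKernel (d := d) ha0 hε
      have hcont : Continuous fun ξ : EuclideanSpace ℝ (Fin d) =>
          ∫ z, truncKernel d a ε z * (1 - Real.cos (inner ℝ ξ z)) := by
        refine continuous_of_dominated (fun ξ => ?_) (fun ξ => ae_of_all _ fun z => ?_)
          (hk.mul_const 2) (ae_of_all _ fun z => by fun_prop)
        · exact ((measurable_truncKernel a ε).mul (by fun_prop)).aestronglyMeasurable
        · rw [Real.norm_of_nonneg (mul_nonneg (truncKernel_nonneg a ε z) (hcos ξ z))]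
          refine mul_le_mul_of_nonneg_left ?_ (truncKernel_nonneg a ε z)
          linarith [Real.neg_one_le_cos (inner ℝ ξ z)]
      have := hu.continuous_fourier
      exact Continuous.aestronglyMeasurable (by fun_prop)
    · rw [norm_mul, norm_mul, norm_exp_I_mul_ofReal, one_mul, Complex.norm_real,
        Real.norm_of_nonneg (integral_nonneg fun z =>
          mul_nonneg (truncKernel_nonneg a ε z) (hcos ξ z)), ← mul_assoc]
      refine mul_le_mul_of_nonneg_right ?_ (norm_nonneg _)
      rw [mul_comm, ← div_eq_mul_inv]
      exact integral_truncKernel_le ha0 ha2 ε ξ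
    · refine Tendsto.mul_const _ (Tendsto.const_mul _ ?_)
      exact (Complex.continuous_ofReal.tendsto _).comp (tendsto_integral_truncKernel ha0 ha2 ξ)
  have hlim2 := ((hlim.const_mul (1 / (2 * (Real.pi : ℂ)) ^ d))).const_mul (fracConst d a : ℂ)
  have hlim3 : Tendsto (fun ε : ℝ => ((fracConst d a *
      ∫ y in {y | ε < ‖x - y‖}, (u x - u y) / ‖x - y‖ ^ ((d : ℝ) + a) : ℝ) : ℂ)) (𝓝[>] 0)
      (𝓝 (l : ℂ)) :=
    (Complex.continuous_ofReal.tendsto _).comp hl.2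
  refine (tendsto_nhds_unique (hlim3.congr' ?_) hlim2).trans ?_
  · filter_upwards [self_mem_nhdsWithin] with ε (hε : 0 < ε)
    rw [Complex.ofReal_mul, hu.truncated_integral_eq ht ha0 hε x]
    rfl
  · rw [fourierMultiplier, mul_left_comm, ← integral_const_mul]
    congr 2
    funext ξ
    have : (fracConst d a : ℂ) ≠ 0 := by exact_mod_cast hC.ne'
    push_cast
    field_simp

theorem MemBarron.norm_fourierMultiplier_sub_le {s αmax h : ℝ} (hu : MemBarron (s + αmax) u)
    (ha0 : 0 < a) (ha2 : a ≤ 2) (haα : a ≤ αmax) (hs0 : 0 < s) (hs2 : s ≤ 2) (hh : 0 < h)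
    (x : EuclideanSpace ℝ (Fin d)) :
    ‖fourierMultiplier (fun ξ => multiplier h ξ ^ (a / 2)) u x -
      fourierMultiplier (fun ξ => ‖ξ‖ ^ a) u x‖ ≤ barronNorm (s + αmax) u * h ^ s := by
  have hM0 : ∀ ξ : EuclideanSpace ℝ (Fin d), 0 ≤ multiplier h ξ ^ (a / 2) := fun ξ =>
    Real.rpow_nonneg (multiplier_nonneg h ξ) _
  have hat : a ≤ s + αmax := by linarith
  have hi1 := hu.integrable_symbol_mul ha0.le hat (continuous_multiplier_rpow h ha0.le)
    (fun ξ => by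
      rw [abs_of_nonneg (hM0 ξ)]
      exact multiplier_rpow_le hh ha0.le ξ) x
  have hi2 := hu.integrable_symbol_mul ha0.le hat (σ := fun ξ => ‖ξ‖ ^ a)
    (continuous_norm.rpow_const fun _ => Or.inr ha0.le)
    (fun ξ => by rw [abs_of_nonneg (by positivity)]) x
  have hnn : 0 ≤ barronNorm (s + αmax) u := integral_nonneg fun ξ => by positivity
  have hc : ‖1 / (2 * (Real.pi : ℂ)) ^ d‖ ≤ 1 := by
    rw [norm_div, norm_one, norm_pow, norm_mul, Complex.norm_real, Complex.norm_ofNat,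
      Real.norm_of_nonneg Real.pi_pos.le]
    refine (div_le_one (by positivity)).2 (one_le_pow₀ ?_)
    linarith [Real.pi_gt_three]
  rw [fourierMultiplier, fourierMultiplier, ← mul_sub, ← integral_sub hi1 hi2, norm_mul]
  refine (mul_le_of_le_one_left (norm_nonneg _) hc).trans ?_
  rw [barronNorm, ← integral_mul_const]
  refine norm_integral_le_of_norm_le (hu.integrable_fourier.mul_const _) (ae_of_all _ fun ξ => ?_)
  rw [← sub_mul, ← mul_sub, norm_mul, norm_mul, norm_exp_I_mul_ofReal, one_mul,
    ← Complex.ofReal_sub, Complex.norm_real, Real.norm_eq_abs, abs_sub_comm,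
    abs_of_nonneg (sub_nonneg.2 (multiplier_rpow_le hh ha0.le ξ)), mul_right_comm]
  refine mul_le_mul_of_nonneg_right ?_ (norm_nonneg _)
  refine (norm_rpow_sub_multiplier_rpow_le hh ha0 ha2 hs0 hs2 ξ).trans ?_
  rw [mul_comm]
  exact mul_le_mul_of_nonneg_right
    (rpow_le_one_add_rpow (norm_nonneg _) (by linarith) (by linarith)) (by positivity)

end PrincipalValue

end VarFracLap

/-! ### Solvability, stability and convergence -/

theorem theorem3 (d : ℕ) (hd : 1 ≤ d)
    (Ω : Set (EuclideanSpace ℝ (Fin d))) (hΩ_open : IsOpen Ω) (hΩ_bdd : Bornology.IsBounded Ω)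
    (αmin αmax : ℝ) (hαmin : 0 < αmin) (hα_le : αmin ≤ αmax) (hαmax : αmax < 2) :
    -- unique solvability, for every step size
    (∀ α b f : EuclideanSpace ℝ (Fin d) → ℝ, VarFracLap.IsOrder αmin αmax α →
      (∀ x ∈ Ω, 0 ≤ b x) → ∀ h : ℝ, 0 < h →
        ∃! v : (Fin d → ℤ) → ℝ, VarFracLap.IsSchemeSolution h Ω α b f v) ∧
    -- stability
    (∀ H : ℝ, 0 < H → ∃ c : ℝ, 0 < c ∧
      ∀ α b f : EuclideanSpace ℝ (Fin d) → ℝ, VarFracLap.IsOrder αmin αmax α →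
        (∀ x ∈ Ω, 0 ≤ b x) → ∀ h : ℝ, 0 < h → h ≤ H →
          ∀ v : (Fin d → ℤ) → ℝ, VarFracLap.IsSchemeSolution h Ω α b f v →
            VarFracLap.gridNorm h Ω v ≤
              c * VarFracLap.gridNorm h Ω (fun j => f (VarFracLap.gridPoint h j))) ∧
    -- convergence
    (∀ H : ℝ, 0 < H → ∀ s : ℝ, 0 < s → s ≤ 2 → ∃ c : ℝ, 0 < c ∧
      ∀ α b f u : EuclideanSpace ℝ (Fin d) → ℝ, VarFracLap.IsOrder αmin αmax α →
        (∀ x ∈ Ω, 0 ≤ b x) → VarFracLap.IsSolution Ω α b f u →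
          VarFracLap.MemBarron (s + αmax) u → ∀ h : ℝ, 0 < h → h ≤ H →
            ∀ v : (Fin d → ℤ) → ℝ, VarFracLap.IsSchemeSolution h Ω α b f v →
              VarFracLap.gridNorm h Ω (fun j => u (VarFracLap.gridPoint h j) - v j) ≤
                c * VarFracLap.barronNorm (s + αmax) u * h ^ s) := by
  refine ⟨fun α b f hα hb h hh => VarFracLap.existsUnique_isSchemeSolution hd hΩ_bdd hαmin hαmax f
    hα hb hh, fun H hH => ?_, fun H hH s hs0 hs2 => ?_⟩
  · obtain ⟨c, hc0, hc⟩ := VarFracLap.exists_stability_const hd hΩ_bdd hαmin hαmax hH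
    exact ⟨c, hc0, fun α b f hα hb h hh hhH v hv =>
      hc α b hα hb h hh hhH v _ hv.equation hv.exterior⟩
  · obtain ⟨c, hc0, hc⟩ := VarFracLap.exists_stability_const hd hΩ_bdd hαmin hαmax hH
    refine ⟨c, hc0, fun α b f u hα hb hu huB h hh hhH v hv => ?_⟩
    have hα0 : ∀ x, 0 < α x := fun x => hαmin.trans_le (hα.mem_Icc x).1
    have hα2 : ∀ x, α x < 2 := fun x => (hα.mem_Icc x).2.trans_lt hαmax
    have hαt : ∀ x, α x ≤ s + αmax := fun x => (hα.mem_Icc x).2.trans (by linarith)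
    have hfin := VarFracLap.finite_gridPoint_mem hΩ_bdd hh
    set S : Finset (Fin d → ℤ) := hfin.toFinset with hS
    have hmem : ∀ j, j ∈ S ↔ VarFracLap.gridPoint h j ∈ Ω := by simp [hS]
    have huS : ∀ k ∉ S, u (VarFracLap.gridPoint h k) = 0 := fun k hk =>
      hu.exterior _ (mt (hmem k).2 hk)
    have hvS : ∀ k ∉ S, v k = 0 := fun k hk => hv.exterior k (mt (hmem k).2 hk)
    set e : (Fin d → ℤ) → ℝ := fun j => u (VarFracLap.gridPoint h j) - v j with he
    have heS : ∀ k ∉ S, e k = 0 := fun k hk => by rw [he]; simp [huS k hk, hvS k hk]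
    -- the error solves the scheme with the consistency error as right-hand side
    have hres : ∀ j, ∃ g : ℝ, VarFracLap.gridPoint h j ∈ Ω →
        VarFracLap.discreteFracLaplacian h (α (VarFracLap.gridPoint h j)) e j +
          ((b (VarFracLap.gridPoint h j) * e j : ℝ) : ℂ) = (g : ℂ) ∧
        |g| ≤ VarFracLap.barronNorm (s + αmax) u * h ^ s := by
      intro j
      by_cases hj : VarFracLap.gridPoint h j ∈ Ω
      swap
      · exact ⟨0, fun hj' => absurd hj' hj⟩
      set x := VarFracLap.gridPoint h j with hx
      obtain ⟨κ, w, hw⟩ := VarFracLap.exists_isJumpKernel (h := h) hd (hα0 x) (hα2 x).le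
      obtain ⟨l, hl, hlf⟩ := hu.equation x hj
      have hlF := hl.eq_fourierMultiplier (hα0 x) (hα2 x) (hαt x) huB
      have hdF := hw.sum_eq_fourierMultiplier (hα0 x) (hαt x) hh huB huS j
      have hve := hv.equation j hj
      rw [hw.discreteFracLaplacian_eq (hα0 x) hh hvS, ← Complex.ofReal_add,
        Complex.ofReal_inj] at hve
      refine ⟨κ * u x - ∑ k ∈ S, w (j - k) * u (VarFracLap.gridPoint h k) - l, fun _ => ⟨?_, ?_⟩⟩
      · rw [hw.discreteFracLaplacian_eq (hα0 x) hh heS, ← Complex.ofReal_add, Complex.ofReal_inj]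
        simp only [he, mul_sub, Finset.sum_sub_distrib]
        linarith
      · have := huB.norm_fourierMultiplier_sub_le (hα0 x) (hα2 x).le (hα.mem_Icc x).2 hs0 hs2 hh x
        rwa [← hlF, ← hdF, ← Complex.ofReal_sub, Complex.norm_real] at this
    choose g hg using hres
    have hB : 0 ≤ VarFracLap.barronNorm (s + αmax) u := integral_nonneg fun ξ => by positivity
    calc VarFracLap.gridNorm h Ω e ≤ c * VarFracLap.gridNorm h Ω g :=
          hc α b hα hb h hh hhH e g (fun j hj => (hg j hj).1) fun j hj =>
            heS j (mt (hmem j).1 hj)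
      _ ≤ c * (VarFracLap.barronNorm (s + αmax) u * h ^ s) := by
          refine mul_le_mul_of_nonneg_left (VarFracLap.gridNorm_le (by positivity) fun j hj =>
            (hg j hj).2) hc0.le
      _ = _ := by ring
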